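/- Let $M$ be a closed (compact, without boundary) connected smooth manifold of positive dimension and let $\omega$ be a symplectic form on $M$, i.e. a smooth closed non-degenerate $2$-form. Let $p:\widetilde M\to M$ be the universal covering. Suppose that $(M,\omega)$ is symplectically hyperbolic, which means that there are a smooth $1$-form $\alpha$ on $\widetilde M$ and a constant $C\in\mathbb R$ with $p^*\omega=d\alpha$ and $\sup_{x\in\widetilde M}|\alpha(x)|\le C$, where $|\alpha(x)|=\max\{\alpha(x)(X) : |X|=1\}$ and $|X|$ is measured in the metric $p^*g$ induced by a Riemannian metric $g$ on $M$ (by compactness of $M$ the condition does not depend on the choice of $g$). Then the fundamental group $\pi_1(M)$ is non-amenable, i.e. there is no left-invariant mean on the bounded real functions on the discrete group $\pi_1(M)$. -/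

import Mathlib

open scoped Manifold ContDiff

noncomputable section

namespace SymplecticHyperbolic

section Forms

variable (E : Type*) [NormedAddCommGroup E] [NormedSpace ℝ E]

/-- A (not necessarily smooth) real differential `k`-form on a manifold `M` modelled on `E`:
an alternating `k`-linear form on every tangent space. -/
abbrev DiffForm (M : Type*) [TopologicalSpace M] [ChartedSpace E M] (k : ℕ) : Type _ :=
  ∀ x : M, (TangentSpace 𝓘(ℝ, E) x) [⋀^Fin k]→L[ℝ] ℝ

variable {E}
variable {M : Type*} [TopologicalSpace M] [ChartedSpace E M]
variable {N : Type*} [TopologicalSpace N] [ChartedSpace E N] {k : ℕ}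

namespace DiffForm

/-- The expression of a form in the preferred chart around `x₀`, i.e. its pullback under the
inverse of the chart. It is meaningful on the (open) target of the chart. -/
def inChart (η : DiffForm E M k) (x₀ : M) (y : E) : E [⋀^Fin k]→L[ℝ] ℝ :=
  (η ((extChartAt 𝓘(ℝ, E) x₀).symm y)).compContinuousLinearMap
    (mfderiv 𝓘(ℝ, E) 𝓘(ℝ, E) (extChartAt 𝓘(ℝ, E) x₀).symm y)

/-- A form is smooth if all its expressions in charts are smooth. -/
def IsSmooth (η : DiffForm E M k) : Prop :=
  ∀ x₀ : M, ContDiffOn ℝ ∞ (η.inChart x₀) (extChartAt 𝓘(ℝ, E) x₀).target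

/-- The exterior derivative of a form: at `x` it is the exterior derivative of the expression of
the form in the preferred chart around `x`, pulled back to the tangent space at `x`. -/
def d (η : DiffForm E M k) : DiffForm E M (k + 1) := fun x =>
  (extDeriv (η.inChart x) (extChartAt 𝓘(ℝ, E) x x)).compContinuousLinearMap
    (mfderiv 𝓘(ℝ, E) 𝓘(ℝ, E) (extChartAt 𝓘(ℝ, E) x) x)

/-- The pullback `p^* η` of a form under a map `p`. -/
def pullback (p : N → M) (η : DiffForm E M k) : DiffForm E N k := fun x =>
  (η (p x)).compContinuousLinearMap (mfderiv 𝓘(ℝ, E) 𝓘(ℝ, E) p x)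

end DiffForm

/-- A symplectic form: a smooth closed non-degenerate `2`-form. -/
structure IsSymplectic (Ω : DiffForm E M 2) : Prop where
  smooth : Ω.IsSmooth
  closed : ∀ x, Ω.d x = 0
  nondegenerate : ∀ (x : M) (v : TangentSpace 𝓘(ℝ, E) x),
    (∀ w : TangentSpace 𝓘(ℝ, E) x, Ω x ![v, w] = 0) → v = 0

variable (E) in
/-- `p : N → M` is a universal covering of the smooth manifold `M`: a covering map from a simply
connected manifold which is a local diffeomorphism. -/
structure IsUniversalCovering (p : N → M) : Prop where
  simplyConnected : SimplyConnectedSpace N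
  isCoveringMap : IsCoveringMap p
  surjective : Function.Surjective p
  isLocalDiffeomorph : IsLocalDiffeomorph 𝓘(ℝ, E) 𝓘(ℝ, E) ∞ p

variable [IsManifold 𝓘(ℝ, E) ∞ M]

/-- A smooth Riemannian metric on `M`. -/
abbrev RiemannianMetricOn (E : Type*) [NormedAddCommGroup E] [NormedSpace ℝ E]
    (M : Type*) [TopologicalSpace M] [ChartedSpace E M] [IsManifold 𝓘(ℝ, E) ∞ M] : Type _ :=
  Bundle.ContMDiffRiemannianMetric (IB := 𝓘(ℝ, E)) (n := ∞) (F := E)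
    (E := fun x : M => TangentSpace 𝓘(ℝ, E) x)

/-- The metric `p^* g` induced on `N` by a Riemannian metric `g` on `M` and a map `p : N → M`. -/
def inducedInner (g : RiemannianMetricOn E M) (p : N → M) (x : N)
    (v w : TangentSpace 𝓘(ℝ, E) x) : ℝ :=
  g.inner (p x) (mfderiv 𝓘(ℝ, E) 𝓘(ℝ, E) p x v) (mfderiv 𝓘(ℝ, E) 𝓘(ℝ, E) p x w)

/-- A form `α` on `N` is bounded with respect to the induced metric `p^* g`: its pointwise norm
`|α(x)| = max {|α(x)(X₁, …, X_k)| : |X₁| = … = |X_k| = 1}` is at most some constant `C` for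
every `x`. -/
def IsBoundedForm (g : RiemannianMetricOn E M) (p : N → M) (α : DiffForm E N k) : Prop :=
  ∃ C : ℝ, ∀ (x : N) (X : Fin k → TangentSpace 𝓘(ℝ, E) x),
    (∀ i, inducedInner g p x (X i) (X i) = 1) → |α x X| ≤ C

/-- With `p : N → M` the universal covering of `M`: the pullback `p^* η` is the differential of a
smooth form that is bounded with respect to the metric induced from a Riemannian metric on `M`. -/
def IsDTildeBounded (p : N → M) (η : DiffForm E M (k + 1)) : Prop :=
  ∃ (g : RiemannianMetricOn E M) (α : DiffForm E N k),
    α.IsSmooth ∧ (∀ x, η.pullback p x = α.d x) ∧ IsBoundedForm g p α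

/-- With `p : N → M` the universal covering of `M`: the form `Ω` is symplectic and hyperbolic. -/
def IsSymplecticallyHyperbolic (p : N → M) (Ω : DiffForm E M 2) : Prop :=
  IsSymplectic Ω ∧ IsDTildeBounded p Ω

end Forms

section Amenable

/-- The space of bounded real functions on `G`. -/
def boundedFunctions (G : Type*) : Submodule ℝ (G → ℝ) where
  carrier := {f | ∃ C : ℝ, ∀ x, |f x| ≤ C}
  zero_mem' := ⟨0, fun x => by simp⟩
  add_mem' := by
    rintro f f' ⟨C, hC⟩ ⟨C', hC'⟩
    exact ⟨C + C', fun x => (abs_add_le _ _).trans (add_le_add (hC x) (hC' x))⟩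
  smul_mem' := by
    rintro c f ⟨C, hC⟩
    refine ⟨|c| * C, fun x => ?_⟩
    simpa [abs_mul] using mul_le_mul_of_nonneg_left (hC x) (abs_nonneg c)

/-- A discrete group is amenable if there is a left-invariant mean on its bounded functions: a
positive normalized linear functional that takes the same value at `f` and at `x ↦ f (a * x)`. -/
def IsAmenable (G : Type*) [Group G] : Prop :=
  ∃ m : boundedFunctions G →ₗ[ℝ] ℝ,
    (∀ f : boundedFunctions G, (∀ x, 0 ≤ f.1 x) → 0 ≤ m f) ∧
    (∀ f : boundedFunctions G, (∀ x, f.1 x = 1) → m f = 1) ∧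
    (∀ (a : G) (f f' : boundedFunctions G), (∀ x, f'.1 x = f.1 (a * x)) → m f' = m f)

end Amenable

end SymplecticHyperbolic

end

/-!
Cover `M` by small sets `U i` with a smooth subordinate partition of unity `φ i`, and lift each
`U i` to the covering space by sections indexed by `π₁(M)`. Pulled back by a section, `α` becomes a
primitive `β` of the symplectic form `Ω` over `U i`, and its Liouville field `X`, given by
`Ω(X, ·) = β`, expands the symplectic volume at the constant rate `dim M / 2`. Let `F i j` be the
integral of `-φ j dφ i(X)`, where `X` comes from the lift of `U j` indexed by `g`; this is a
function of `g`, bounded because `α` is. For fixed `i`, after translating `g` so that all the lifts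
agree over `U i`, the `F i j` add up to `dim M / 2` times the integral of `φ i`, by the divergence
theorem. For fixed `j` they add up to zero, since the `φ i` sum to one. An invariant mean does not
see the translations, so if there were one, `dim M / 2` times the volume of `M` would be zero.
-/

noncomputable section

namespace SymplecticHyperbolic

section Euclidean

open MeasureTheory Matrix Module

variable {E : Type*} [NormedAddCommGroup E] [NormedSpace ℝ E]

section Jacobi

variable {ι : Type*} [Fintype ι] [DecidableEq ι]

theorem hasFDerivAt_det {Q : E → Matrix ι ι ℝ} {Q' : ι → ι → E →L[ℝ] ℝ} {y : E}
    (hQ : ∀ k l, HasFDerivAt (fun z => Q z k l) (Q' k l) y) :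
    HasFDerivAt (fun z => (Q z).det) (∑ k, ∑ l, (Q y).adjugate l k • Q' k l) y := by
  let detRows : ContinuousMultilinearMap ℝ (fun _ : ι => ι → ℝ) ℝ :=
    { toMultilinearMap := (detRowAlternating (n := ι) (R := ℝ)).toMultilinearMap
      cont := Continuous.matrix_det (A := fun m : ι → ι → ℝ => Matrix.of m) continuous_id }
  have hrows := HasFDerivAt.multilinear_comp detRows (g := fun k z => Q z k)
    (g' := fun k => ContinuousLinearMap.pi (Q' k)) (x := y)
    (fun k => hasFDerivAt_pi.2 (hQ k))
  refine hrows.congr_fderiv ?_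
  ext v
  simp only [_root_.sum_apply, ContinuousLinearMap.comp_apply, _root_.smul_apply, smul_eq_mul]
  refine Finset.sum_congr rfl fun k _ => ?_
  change ((Q y).updateRow k (fun l => Q' k l v)).det = _
  rw [← cramer_transpose_apply, cramer_eq_adjugate_mulVec, ← adjugate_transpose]
  simp only [mulVec, dotProduct, transpose_apply]

end Jacobi

theorem contDiff_of_tsupport {F : Type*} [NormedAddCommGroup F] [NormedSpace ℝ F]
    {n : WithTop ℕ∞} {f : E → F} (h : ∀ x ∈ tsupport f, ContDiffAt ℝ n f x) : ContDiff ℝ n f :=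
  contMDiff_iff_contDiff.1 (contMDiff_of_tsupport fun x hx => contMDiffAt_iff_contDiffAt.2 (h x hx))

theorem hasFDerivAt_apply_apply {T : E → E →L[ℝ] E →L[ℝ] ℝ} {y : E}
    (hT : DifferentiableAt ℝ T y) (s t : E) :
    HasFDerivAt (fun z => T z s t) ((ContinuousLinearMap.apply ℝ ℝ t ∘L
      ContinuousLinearMap.apply ℝ (E →L[ℝ] ℝ) s) ∘L fderiv ℝ T y) y :=
  HasFDerivAt.comp (g := ContinuousLinearMap.apply ℝ ℝ t ∘L
    ContinuousLinearMap.apply ℝ (E →L[ℝ] ℝ) s) y (ContinuousLinearMap.hasFDerivAt _) hT.hasFDerivAt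

/-- The two-form `B` on the open set `V` is symplectic with primitive `a`: it is smooth and
non-degenerate, and `B = da` there. -/
structure IsExactSymplecticOn (B : E → E →L[ℝ] E →L[ℝ] ℝ) (a : E → E →L[ℝ] ℝ) (V : Set E) :
    Prop where
  isOpen : IsOpen V
  contDiffOn : ContDiffOn ℝ ∞ B V
  contDiffOn_primitive : ContDiffOn ℝ ∞ a V
  isInvertible : ∀ y ∈ V, (B y).IsInvertible
  eq_fderiv_sub : ∀ y ∈ V, ∀ u v, B y u v = fderiv ℝ a y u v - fderiv ℝ a y v u

/-- The Liouville vector field of the primitive `a` of `B`, defined by `B(X, ·) = a`. -/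
def liouvilleField (B : E → E →L[ℝ] E →L[ℝ] ℝ) (a : E → E →L[ℝ] ℝ) (y : E) : E :=
  (B y).inverse (a y)

namespace IsExactSymplecticOn

variable {V : Set E} {B : E → E →L[ℝ] E →L[ℝ] ℝ} {a : E → E →L[ℝ] ℝ} {y : E}

theorem neg_swap (h : IsExactSymplecticOn B a V) (hy : y ∈ V) (u v : E) :
    B y u v = -B y v u := by
  rw [h.eq_fderiv_sub y hy, h.eq_fderiv_sub y hy]
  ring

theorem apply_liouvilleField (h : IsExactSymplecticOn B a V) (hy : y ∈ V) :
    B y (liouvilleField B a y) = a y :=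
  ((h.isInvertible y hy).inverse_apply_eq.1 rfl).symm

theorem differentiableAt (h : IsExactSymplecticOn B a V) (hy : y ∈ V) : DifferentiableAt ℝ B y :=
  (h.contDiffOn.contDiffAt (h.isOpen.mem_nhds hy)).differentiableAt (by simp)

theorem fderiv_apply_apply (h : IsExactSymplecticOn B a V) (hy : y ∈ V) (u v w : E) :
    fderiv ℝ B y u v w = fderiv ℝ (fderiv ℝ a) y u v w - fderiv ℝ (fderiv ℝ a) y u w v := by
  have ha' : DifferentiableAt ℝ (fderiv ℝ a) y :=
    ((h.contDiffOn_primitive.contDiffAt (h.isOpen.mem_nhds hy)).fderiv_right (m := 1)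
      (by norm_cast)).differentiableAt one_ne_zero
  have heq : (fun z => B z v w) =ᶠ[nhds y] fun z => fderiv ℝ a z v w - fderiv ℝ a z w v :=
    Filter.eventually_of_mem (h.isOpen.mem_nhds hy) fun z hz => h.eq_fderiv_sub z hz v w
  have hderiv := (hasFDerivAt_apply_apply (h.differentiableAt hy) v w).unique
    (((hasFDerivAt_apply_apply ha' v w).sub
      (hasFDerivAt_apply_apply ha' w v)).congr_of_eventuallyEq heq)
  exact congrArg (fun f : E →L[ℝ] ℝ => f u) hderiv

end IsExactSymplecticOn

variable [FiniteDimensional ℝ E]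

theorem isInvertible_of_injective {B : E →L[ℝ] E →L[ℝ] ℝ} (hB : Function.Injective B) :
    B.IsInvertible := by
  have hdim : finrank ℝ E = finrank ℝ (E →L[ℝ] ℝ) := by
    rw [← (LinearMap.toContinuousLinearMap (𝕜 := ℝ) (E := E) (F' := ℝ)).finrank_eq]
    exact Subspace.dual_finrank_eq.symm
  exact ⟨(LinearMap.linearEquivOfInjective (B : E →ₗ[ℝ] E →L[ℝ] ℝ) hB hdim).toContinuousLinearEquiv,
    rfl⟩

theorem contDiffOn_inverse_apply {n : WithTop ℕ∞} {V : Set E} {B : E → E →L[ℝ] E →L[ℝ] ℝ}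
    {a : E → E →L[ℝ] ℝ} (hB : ContDiffOn ℝ n B V) (ha : ContDiffOn ℝ n a V)
    (hinv : ∀ y ∈ V, (B y).IsInvertible) : ContDiffOn ℝ n (fun y => (B y).inverse (a y)) V :=
  fun y hy => ((hinv y hy).contDiffAt_map_inverse.comp_contDiffWithinAt y (hB y hy)).clm_apply
    (ha y hy)

/-- The Gram matrix of a bilinear form in a fixed basis. -/
def gram (B : E →L[ℝ] E →L[ℝ] ℝ) : Matrix (Fin (finrank ℝ E)) (Fin (finrank ℝ E)) ℝ :=
  LinearMap.BilinForm.toMatrix (finBasis ℝ E) B.toBilinForm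

/-- The density, with respect to Lebesgue measure in the coordinates of the fixed basis, of the
volume determined by a bilinear form. -/
def density (B : E →L[ℝ] E →L[ℝ] ℝ) : ℝ := √|(gram B).det|

theorem gram_apply (B : E →L[ℝ] E →L[ℝ] ℝ) (k l : Fin (finrank ℝ E)) :
    gram B k l = B (finBasis ℝ E k) (finBasis ℝ E l) :=
  LinearMap.BilinForm.toMatrix_apply _ _ _ _

theorem gram_bilinearComp (B : E →L[ℝ] E →L[ℝ] ℝ) (L R : E →L[ℝ] E) :
    gram (B.bilinearComp L R) =
      (LinearMap.toMatrix (finBasis ℝ E) (finBasis ℝ E) L)ᵀ * gram B *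
        LinearMap.toMatrix (finBasis ℝ E) (finBasis ℝ E) R :=
  LinearMap.BilinForm.toMatrix_comp (finBasis ℝ E) (finBasis ℝ E) B.toBilinForm L R

theorem density_bilinearComp (B : E →L[ℝ] E →L[ℝ] ℝ) (L : E →L[ℝ] E) :
    density (B.bilinearComp L L) = |L.det| * density B := by
  have hdet : (gram (B.bilinearComp L L)).det = L.det ^ 2 * (gram B).det := by
    rw [gram_bilinearComp, det_mul, det_mul, det_transpose, LinearMap.det_toMatrix,
      ContinuousLinearMap.det]
    ring
  rw [density, density, hdet, abs_mul, Real.sqrt_mul (abs_nonneg _), abs_pow,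
    Real.sqrt_sq (abs_nonneg _)]

theorem gram_det_ne_zero {B : E →L[ℝ] E →L[ℝ] ℝ} (hB : B.IsInvertible) : (gram B).det ≠ 0 := by
  obtain ⟨e, rfl⟩ := hB
  refine (LinearMap.BilinForm.nondegenerate_iff_det_ne_zero (finBasis ℝ E)).1
    (LinearMap.BilinForm.nondegenerate_iff_ker_eq_bot.2 (LinearMap.ker_eq_bot'.2 fun v hv => ?_))
  exact (map_eq_zero_iff e e.injective).1 (ContinuousLinearMap.ext (LinearMap.congr_fun hv))

theorem density_pos {B : E →L[ℝ] E →L[ℝ] ℝ} (hB : B.IsInvertible) : 0 < density B :=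
  Real.sqrt_pos.2 (abs_pos.2 (gram_det_ne_zero hB))

theorem density_nonneg (B : E →L[ℝ] E →L[ℝ] ℝ) : 0 ≤ density B := Real.sqrt_nonneg _

theorem continuous_density : Continuous (density (E := E)) := by
  refine Real.continuous_sqrt.comp (continuous_abs.comp (Continuous.matrix_det ?_))
  refine continuous_matrix fun k l => ?_
  simp only [gram_apply]
  fun_prop

theorem contDiffAt_density {n : WithTop ℕ∞} {B : E → E →L[ℝ] E →L[ℝ] ℝ} {y : E}
    (hB : ContDiffAt ℝ n B y) (hinv : (B y).IsInvertible) :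
    ContDiffAt ℝ n (fun z => density (B z)) y := by
  have hdet : ContDiffAt ℝ n (fun z => (gram (B z)).det) y := by
    simp only [det_apply, gram_apply]
    refine ContDiffAt.sum fun σ _ => ContDiffAt.const_smul _ (contDiffAt_prod fun k _ => ?_)
    exact (hB.clm_apply contDiffAt_const).clm_apply contDiffAt_const
  simp only [density, ← Real.norm_eq_abs]
  exact (hdet.norm ℝ (gram_det_ne_zero hinv)).sqrt (norm_ne_zero_iff.2 (gram_det_ne_zero hinv))

theorem fderiv_density {B : E → E →L[ℝ] E →L[ℝ] ℝ} {y : E} (hB : DifferentiableAt ℝ B y)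
    (hinv : (B y).IsInvertible) (v : E) :
    fderiv ℝ (fun z => density (B z)) y v =
      density (B y) / 2 * ((gram (B y))⁻¹ * gram (fderiv ℝ B y v)).trace := by
  have hdet := gram_det_ne_zero hinv
  have hgram : ∀ k l, HasFDerivAt (fun z => gram (B z) k l)
      ((ContinuousLinearMap.apply ℝ ℝ (finBasis ℝ E l) ∘L
        ContinuousLinearMap.apply ℝ (E →L[ℝ] ℝ) (finBasis ℝ E k)) ∘L fderiv ℝ B y) y := by
    intro k l
    simp only [gram_apply]
    exact hasFDerivAt_apply_apply hB _ _
  have hdet' := hasFDerivAt_det hgram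
  have sqrt_abs_eq_exp : ∀ {d : ℝ}, d ≠ 0 → √|d| = Real.exp (1 / 2 * Real.log d) := by
    intro d hd
    rw [Real.sqrt_eq_rpow, Real.rpow_def_of_pos (abs_pos.2 hd), Real.log_abs, mul_comm]
  have hdensity := (((hdet'.log hdet).const_mul (1 / 2)).exp).congr_of_eventuallyEq
    (f₁ := fun z => density (B z))
    ((hdet'.continuousAt.eventually_ne hdet).mono fun z hz => sqrt_abs_eq_exp hz)
  rw [hdensity.fderiv, ← sqrt_abs_eq_exp hdet]
  simp only [_root_.smul_apply, _root_.sum_apply, ContinuousLinearMap.comp_apply,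
    ContinuousLinearMap.apply_apply, smul_eq_mul, Matrix.trace, diag, mul_apply, inv_def,
    Ring.inverse_eq_inv', Matrix.smul_apply, gram_apply, density, Finset.mul_sum]
  rw [Finset.sum_comm]
  refine Finset.sum_congr rfl fun k _ => Finset.sum_congr rfl fun l _ => ?_
  ring

/-- If `B'` is the derivative of `B` along a vector field whose derivative is `L`, the hypothesis
says that the Lie derivative of `B` along that field is `B`. -/
theorem trace_of_lieDerivative_eq {B B' : E →L[ℝ] E →L[ℝ] ℝ} {L : E →L[ℝ] E}
    (hinv : B.IsInvertible) (h : ∀ u v, B' u v + B (L u) v + B u (L v) = B u v) :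
    ((gram B)⁻¹ * gram B').trace + 2 * LinearMap.trace ℝ E L = finrank ℝ E := by
  have hunit : IsUnit (gram B).det := (gram_det_ne_zero hinv).isUnit
  set P := LinearMap.toMatrix (finBasis ℝ E) (finBasis ℝ E) L with hP
  have hleft := gram_bilinearComp B L (ContinuousLinearMap.id ℝ E)
  have hright := gram_bilinearComp B (ContinuousLinearMap.id ℝ E) L
  rw [ContinuousLinearMap.coe_id, LinearMap.toMatrix_id, mul_one] at hleft
  rw [ContinuousLinearMap.coe_id, LinearMap.toMatrix_id, transpose_one, one_mul] at hright
  have hgram : gram B' + Pᵀ * gram B + gram B * P = gram B := by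
    rw [← hleft, ← hright]
    ext k l
    simp only [Matrix.add_apply, gram_apply]
    exact h _ _
  have htrace := congrArg (fun Q => ((gram B)⁻¹ * Q).trace) hgram
  simp only [mul_add, trace_add] at htrace
  rw [nonsing_inv_mul _ hunit, ← mul_assoc _ (gram B) P, nonsing_inv_mul _ hunit, one_mul,
    trace_one, Fintype.card_fin, ← mul_assoc, trace_mul_comm ((gram B)⁻¹ * Pᵀ), ← mul_assoc,
    mul_nonsing_inv _ hunit, one_mul, trace_transpose] at htrace
  rw [LinearMap.trace_eq_matrix_trace ℝ (finBasis ℝ E), ← hP]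
  linarith

section Divergence

variable [MeasurableSpace E] [BorelSpace E] (μ : Measure E) [μ.IsAddHaarMeasure]

theorem integrable_trace_fderiv {Z : E → E} (hZ : ContDiff ℝ 1 Z) (hc : HasCompactSupport Z) :
    Integrable (fun y => LinearMap.trace ℝ E (fderiv ℝ Z y)) μ := by
  let traceL : (E →L[ℝ] E) →L[ℝ] ℝ :=
    LinearMap.toContinuousLinearMap (LinearMap.trace ℝ E ∘ₗ ContinuousLinearMap.coeLM ℝ)
  exact (traceL.continuous.comp (hZ.continuous_fderiv one_ne_zero)).integrable_of_hasCompactSupport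
    ((hc.fderiv (𝕜 := ℝ)).comp_left (g := traceL) (map_zero traceL))

theorem integral_fderiv_apply_eq_zero {f : E → ℝ} (hf : ContDiff ℝ 1 f) (hc : HasCompactSupport f)
    (v : E) : ∫ y, fderiv ℝ f y v ∂μ = 0 := by
  have hf' : Integrable (fun y => fderiv ℝ f y v) μ :=
    ((hf.continuous_fderiv one_ne_zero).clm_apply continuous_const).integrable_of_hasCompactSupport
      (hc.fderiv_apply (𝕜 := ℝ) v)
  simpa using integral_mul_fderiv_eq_neg_fderiv_mul_of_integrable (f := fun _ : E => (1 : ℝ))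
    (v := v) (by simp) (by simpa using hf')
    (by simpa using hf.continuous.integrable_of_hasCompactSupport hc)
    (fun _ _ => differentiableAt_const _) (fun y _ => hf.differentiable one_ne_zero y)

theorem integral_trace_fderiv_eq_zero {Z : E → E} (hZ : ContDiff ℝ 1 Z)
    (hc : HasCompactSupport Z) : ∫ y, LinearMap.trace ℝ E (fderiv ℝ Z y) ∂μ = 0 := by
  let coord : Fin (finrank ℝ E) → E →L[ℝ] ℝ := fun k =>
    ((finBasis ℝ E).coord k).toContinuousLinearMap
  have hcoord : ∀ k, ContDiff ℝ 1 (fun z => coord k (Z z)) := fun k => (coord k).contDiff.comp hZ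
  have hcoord_c : ∀ k, HasCompactSupport (fun z => coord k (Z z)) := fun k =>
    hc.comp_left (g := coord k) (map_zero _)
  have htrace : ∀ y, LinearMap.trace ℝ E (fderiv ℝ Z y) =
      ∑ k, fderiv ℝ (fun z => coord k (Z z)) y (finBasis ℝ E k) := by
    intro y
    have hcomp : ∀ k, fderiv ℝ (fun z => coord k (Z z)) y = coord k ∘L fderiv ℝ Z y := fun k =>
      ((coord k).hasFDerivAt.comp y (hZ.differentiable one_ne_zero y).hasFDerivAt).fderiv
    simp only [LinearMap.trace_eq_matrix_trace ℝ (finBasis ℝ E), Matrix.trace, diag,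
      LinearMap.toMatrix_apply, hcomp]
    rfl
  simp_rw [htrace]
  rw [integral_finsetSum]
  · exact Finset.sum_eq_zero fun k _ => integral_fderiv_apply_eq_zero μ (hcoord k) (hcoord_c k) _
  · exact fun k _ => (((hcoord k).continuous_fderiv one_ne_zero).clm_apply
      continuous_const).integrable_of_hasCompactSupport ((hcoord_c k).fderiv_apply (𝕜 := ℝ) _)

end Divergence

namespace IsExactSymplecticOn

variable {V : Set E} {B : E → E →L[ℝ] E →L[ℝ] ℝ} {a : E → E →L[ℝ] ℝ} {y : E}

theorem contDiffOn_liouvilleField (h : IsExactSymplecticOn B a V) :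
    ContDiffOn ℝ ∞ (liouvilleField B a) V :=
  contDiffOn_inverse_apply h.contDiffOn h.contDiffOn_primitive h.isInvertible

theorem differentiableAt_liouvilleField (h : IsExactSymplecticOn B a V) (hy : y ∈ V) :
    DifferentiableAt ℝ (liouvilleField B a) y :=
  (h.contDiffOn_liouvilleField.contDiffAt (h.isOpen.mem_nhds hy)).differentiableAt (by simp)

theorem fderiv_primitive_apply (h : IsExactSymplecticOn B a V) (hy : y ∈ V) (u v : E) :
    fderiv ℝ a y u v = fderiv ℝ B y u (liouvilleField B a y) v +
      B y (fderiv ℝ (liouvilleField B a) y u) v := by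
  have heq : (fun z => B z (liouvilleField B a z)) =ᶠ[nhds y] a :=
    Filter.eventually_of_mem (h.isOpen.mem_nhds hy) fun z hz => h.apply_liouvilleField hz
  rw [← heq.fderiv_eq, ((h.differentiableAt hy).hasFDerivAt.clm_apply
    (h.differentiableAt_liouvilleField hy).hasFDerivAt).fderiv]
  simp [add_comm]

/-- By Cartan's formula the Lie derivative of `B = da` along its Liouville field is `B`. -/
theorem lieDerivative_eq (h : IsExactSymplecticOn B a V) (hy : y ∈ V) (u v : E) :
    fderiv ℝ B y (liouvilleField B a y) u v + B y (fderiv ℝ (liouvilleField B a) y u) v +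
      B y u (fderiv ℝ (liouvilleField B a) y v) = B y u v := by
  have hsymm : ∀ s t, fderiv ℝ (fderiv ℝ a) y s t = fderiv ℝ (fderiv ℝ a) y t s :=
    fun s t => ((h.contDiffOn_primitive.contDiffAt
      (h.isOpen.mem_nhds hy)).isSymmSndFDerivAt (by simp; norm_cast)).eq s t
  have hda := h.eq_fderiv_sub y hy u v
  have hanti := h.neg_swap hy u (fderiv ℝ (liouvilleField B a) y v)
  rw [h.fderiv_primitive_apply hy, h.fderiv_primitive_apply hy, h.fderiv_apply_apply hy,
    h.fderiv_apply_apply hy, hsymm u (liouvilleField B a y), hsymm v (liouvilleField B a y),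
    hsymm v u] at hda
  rw [h.fderiv_apply_apply hy]
  linarith

theorem trace_fderiv_smul_liouvilleField (h : IsExactSymplecticOn B a V) (hy : y ∈ V)
    {φ : E → ℝ} (hφ : DifferentiableAt ℝ φ y) :
    LinearMap.trace ℝ E (fderiv ℝ (fun z => (φ z * density (B z)) • liouvilleField B a z) y) =
      fderiv ℝ φ y (liouvilleField B a y) * density (B y) +
        finrank ℝ E / 2 * (φ y * density (B y)) := by
  have hdensity : DifferentiableAt ℝ (fun z => density (B z)) y :=
    (contDiffAt_density (n := 1) ((h.contDiffOn.contDiffAt (h.isOpen.mem_nhds hy)).of_le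
      (by norm_cast)) (h.isInvertible y hy)).differentiableAt one_ne_zero
  have trace_smulRight : ∀ (f : E →L[ℝ] ℝ) (x : E),
      LinearMap.trace ℝ E (f.smulRight x : E →L[ℝ] E) = f x := fun f x =>
    LinearMap.trace_smulRight (f : E →ₗ[ℝ] ℝ) x
  have hdiv := congrArg (fun T : E →L[ℝ] E => LinearMap.trace ℝ E T)
    ((hφ.hasFDerivAt.mul hdensity.hasFDerivAt).smul
      (h.differentiableAt_liouvilleField hy).hasFDerivAt).fderiv
  simp only [ContinuousLinearMap.toLinearMap_add, map_add, trace_smulRight,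
    ContinuousLinearMap.toLinearMap_smul, map_smul, _root_.add_apply, _root_.smul_apply,
    smul_eq_mul, fderiv_density (h.differentiableAt hy) (h.isInvertible y hy),
    Pi.mul_apply] at hdiv
  refine Eq.trans hdiv ?_
  linear_combination (φ y * density (B y) / 2) *
    trace_of_lieDerivative_eq (h.isInvertible y hy) (h.lieDerivative_eq hy)

theorem contDiff_mul_density (h : IsExactSymplecticOn B a V) {φ : E → ℝ} (hφ : ContDiff ℝ ∞ φ)
    (hs : tsupport φ ⊆ V) : ContDiff ℝ ∞ (fun y => φ y * density (B y)) :=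
  contDiff_of_tsupport fun y hy => by
    have hyV : y ∈ V := hs (closure_mono (Function.support_mul_subset_left _ _) hy)
    exact hφ.contDiffAt.mul (contDiffAt_density (h.contDiffOn.contDiffAt (h.isOpen.mem_nhds hyV))
      (h.isInvertible y hyV))

theorem contDiff_smul_liouvilleField (h : IsExactSymplecticOn B a V) {φ : E → ℝ}
    (hφ : ContDiff ℝ ∞ φ) (hs : tsupport φ ⊆ V) :
    ContDiff ℝ ∞ (fun y => (φ y * density (B y)) • liouvilleField B a y) :=
  contDiff_of_tsupport fun y hy => by
    have hyV : y ∈ V := hs (closure_mono ((Function.support_smul_subset_left _ _).trans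
      (Function.support_mul_subset_left _ _)) hy)
    exact (h.contDiff_mul_density hφ hs).contDiffAt.smul
      (h.contDiffOn_liouvilleField.contDiffAt (h.isOpen.mem_nhds hyV))

theorem integral_fderiv_liouvilleField [MeasurableSpace E] [BorelSpace E] (μ : Measure E)
    [μ.IsAddHaarMeasure] (h : IsExactSymplecticOn B a V) {φ : E → ℝ} (hφ : ContDiff ℝ ∞ φ)
    (hc : HasCompactSupport φ) (hs : tsupport φ ⊆ V) :
    ∫ y, fderiv ℝ φ y (liouvilleField B a y) * density (B y) ∂μ =
      -(finrank ℝ E / 2 * ∫ y, φ y * density (B y) ∂μ) := by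
  have hdiv : ∀ y, fderiv ℝ φ y (liouvilleField B a y) * density (B y) =
      LinearMap.trace ℝ E (fderiv ℝ (fun z => (φ z * density (B z)) • liouvilleField B a z) y) -
        finrank ℝ E / 2 * (φ y * density (B y)) := by
    intro y
    rw [eq_sub_iff_add_eq]
    by_cases hy : y ∈ tsupport φ
    · exact (h.trace_fderiv_smul_liouvilleField (hs hy) (hφ.differentiable (by simp) y)).symm
    · have hφ0 : φ =ᶠ[nhds y] 0 := notMem_tsupport_iff_eventuallyEq.1 hy
      have hZ0 : (fun z => (φ z * density (B z)) • liouvilleField B a z) =ᶠ[nhds y] fun _ => 0 :=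
        hφ0.mono fun z hz => by simp [hz]
      rw [hZ0.fderiv_eq, hφ0.fderiv_eq, hφ0.self_of_nhds]
      simp
  have hφρ : HasCompactSupport (fun y => φ y * density (B y)) := hc.mul_right
  have hZ := (h.contDiff_smul_liouvilleField hφ hs).of_le (m := 1) (by norm_cast)
  have hZc : HasCompactSupport (fun y => (φ y * density (B y)) • liouvilleField B a y) :=
    hφρ.smul_right
  have hint : Integrable (fun y => φ y * density (B y)) μ :=
    (h.contDiff_mul_density hφ hs).continuous.integrable_of_hasCompactSupport hφρ
  simp_rw [hdiv]
  rw [integral_sub (integrable_trace_fderiv μ hZ hZc) (hint.const_mul _),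
    integral_trace_fderiv_eq_zero μ hZ hZc, integral_const_mul, zero_sub]

/-- The value of `a` on the Hamiltonian field `B⁻¹(dφ)` is `-dφ(X)` for the Liouville field `X`. -/
theorem integral_primitive_inverse_fderiv [MeasurableSpace E] [BorelSpace E] (μ : Measure E)
    [μ.IsAddHaarMeasure] (h : IsExactSymplecticOn B a V) {φ : E → ℝ} (hφ : ContDiff ℝ ∞ φ)
    (hc : HasCompactSupport φ) (hs : tsupport φ ⊆ V) :
    ∫ y, a y ((B y).inverse (fderiv ℝ φ y)) * density (B y) ∂μ =
      finrank ℝ E / 2 * ∫ y, φ y * density (B y) ∂μ := by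
  have hswap : ∀ y, a y ((B y).inverse (fderiv ℝ φ y)) =
      -fderiv ℝ φ y (liouvilleField B a y) := by
    intro y
    by_cases hy : y ∈ tsupport φ
    · have hH : B y ((B y).inverse (fderiv ℝ φ y)) = fderiv ℝ φ y :=
        ((h.isInvertible y (hs hy)).inverse_apply_eq.1 rfl).symm
      rw [← h.apply_liouvilleField (hs hy), h.neg_swap (hs hy), hH]
    · rw [(notMem_tsupport_iff_eventuallyEq.1 hy).fderiv_eq]
      simp
  simp_rw [hswap, neg_mul]
  rw [integral_neg, h.integral_fderiv_liouvilleField μ hφ hc hs, neg_neg]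

end IsExactSymplecticOn

end Euclidean

section Coverings

variable {M N : Type*} [TopologicalSpace M] [TopologicalSpace N] {p : N → M}

/-- `t` is a continuous section of `p` over `W`. -/
structure IsSectionOn (p : N → M) (t : M → N) (W : Set M) : Prop where
  continuousOn : ContinuousOn t W
  right_inv : ∀ x ∈ W, p (t x) = x

namespace IsSectionOn

variable {s t : M → N} {U W : Set M}

theorem mono (h : IsSectionOn p t W) (hU : U ⊆ W) : IsSectionOn p t U :=
  ⟨h.continuousOn.mono hU, fun x hx => h.right_inv x (hU hx)⟩

theorem eqOn (hs : IsSectionOn p s U) (ht : IsSectionOn p t U) (cov : IsCoveringMap p)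
    (hU : IsPreconnected U) {x : M} (hx : x ∈ U) (hst : s x = t x) : U.EqOn s t :=
  cov.eqOn_of_comp_eqOn hU hs.continuousOn ht.continuousOn
    (fun y hy => (hs.right_inv y hy).trans (ht.right_inv y hy).symm) hx hst

theorem monodromy_eq (ht : IsSectionOn p t W) (cov : IsCoveringMap p) {x y : M} (γ : Path x y)
    (hγ : ∀ r, γ r ∈ W) (e : p ⁻¹' {x}) (he : t x = e) :
    (cov.monodromy (.mk γ) e : N) = t y := by
  have hlift : (fun r => t (γ r)) = cov.liftPath γ e (γ.source.trans e.2.symm) :=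
    (cov.eq_liftPath_iff _).2 ⟨ht.continuousOn.comp_continuous γ.continuous hγ,
      funext fun r => ht.right_inv _ (hγ r), by simpa only [γ.source] using he⟩
  have hend := congrFun hlift 1
  simp only [γ.target] at hend
  exact hend.symm

end IsSectionOn

/-- Through every point over `W` there is a section of `p` over `W`. -/
def HasSectionsOn (p : N → M) (W : Set M) : Prop :=
  ∀ z, p z ∈ W → ∃ t, IsSectionOn p t W ∧ t (p z) = z

theorem HasSectionsOn.mono {U W : Set M} (h : HasSectionsOn p W) (hU : U ⊆ W) :
    HasSectionsOn p U := fun z hz =>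
  let ⟨t, ht, htz⟩ := h z (hU hz)
  ⟨t, ht.mono hU, htz⟩

theorem exists_hasSectionsOn (cov : IsCoveringMap p) (hp : Function.Surjective p) (x : M) :
    ∃ W, IsOpen W ∧ x ∈ W ∧ HasSectionsOn p W := by
  obtain ⟨z₀, hz₀⟩ := hp x
  have : Nonempty (p ⁻¹' {x}) := ⟨⟨z₀, hz₀⟩⟩
  let e := (cov x).toTrivialization
  refine ⟨e.baseSet, e.open_baseSet, (cov x).mem_toTrivialization_baseSet, fun z hz => ?_⟩
  refine ⟨fun y => e.toOpenPartialHomeomorph.symm (y, (e z).2), ⟨?_, fun y hy => ?_⟩, ?_⟩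
  · refine e.continuousOn_invFun.comp (by fun_prop) fun y hy => ?_
    exact e.mem_target.2 hy
  · exact e.proj_symm_apply' hy
  · exact e.symm_apply_mk_proj (e.mem_source.2 hz)

/-- Sections over overlapping sets are matched by an element of the fundamental group: a loop
through the two sets, based at `x₀`. -/
theorem exists_equivariant_sections [PathConnectedSpace M] (cov : IsCoveringMap p)
    (hp : Function.Surjective p) (x₀ : M) {ι : Type*} {U : ι → Set M}
    (hU : ∀ i, IsPathConnected (U i))
    (hsec : ∀ i j, (U i ∩ U j).Nonempty → HasSectionsOn p (U i ∪ U j)) :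
    ∃ s : ι → FundamentalGroup M x₀ → M → N, (∀ i g, IsSectionOn p (s i g) (U i)) ∧
      ∀ i j, (U i ∩ U j).Nonempty →
        ∃ a : FundamentalGroup M x₀, ∀ g, (U i ∩ U j).EqOn (s i g) (s j (a * g)) := by
  obtain ⟨n₀, hn₀⟩ := hp x₀
  choose c hc using fun i => (hU i).nonempty
  let C : ∀ i, Path.Homotopic.Quotient x₀ (c i) := fun i => .mk (PathConnectedSpace.somePath x₀ _)
  let e : ∀ i, FundamentalGroup M x₀ → p ⁻¹' {c i} := fun i g =>
    cov.monodromy (C i) (cov.monodromy g.toPath ⟨n₀, hn₀⟩)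
  have hpe : ∀ i g, p (e i g) = c i := fun i g => (e i g).2
  have hsec_self : ∀ i, HasSectionsOn p (U i) := fun i =>
    (hsec i i (by simpa only [Set.inter_self] using (hU i).nonempty)).mono Set.subset_union_left
  choose s hs hse using fun i g => hsec_self i (e i g) (by rw [hpe]; exact hc i)
  simp only [hpe] at hse
  refine ⟨s, hs, fun i j hij => ?_⟩
  have hjoin := ((hU i).union (hU j) hij).joinedIn _ (.inl (hc i)) _ (.inr (hc j))
  let κ : Path.Homotopic.Quotient (c i) (c j) := .mk hjoin.somePath
  refine ⟨.fromPath (((C i).trans κ).trans (C j).symm), fun g => ?_⟩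
  have he : e j (.fromPath (((C i).trans κ).trans (C j).symm) * g) = cov.monodromy κ (e i g) := by
    change cov.monodromy (C j) (cov.monodromy
      (g.toPath.trans (((C i).trans κ).trans (C j).symm)) ⟨n₀, hn₀⟩) = _
    simp only [cov.monodromy_trans_apply]
    rw [← cov.monodromy_trans_apply _ (C j), Path.Homotopic.Quotient.symm_trans,
      cov.monodromy_refl, id]
  obtain ⟨t, ht, hte⟩ := hsec i j hij (e i g) (by rw [hpe]; exact .inl (hc i))
  rw [hpe] at hte
  have hsi : (U i).EqOn (s i g) t :=
    (hs i g).eqOn (ht.mono Set.subset_union_left) cov (hU i).isConnected.isPreconnected (hc i)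
      ((hse i g).trans hte.symm)
  have hsj : (U j).EqOn (s j _) t :=
    (hs j _).eqOn (ht.mono Set.subset_union_right) cov (hU j).isConnected.isPreconnected (hc j) <|
      (hse j _).trans <| by rw [he]; exact ht.monodromy_eq cov _ hjoin.somePath_mem _ hte
  exact fun x hx => (hsi hx.1).trans (hsj hx.2).symm

open Metric in
theorem exists_cover_hasSectionsOn_union [CompactSpace M] [TopologicalSpace.MetrizableSpace M]
    [LocallyPathConnectedSpace M] (cov : IsCoveringMap p) (hp : Function.Surjective p)
    {O : M → Set M} (hO : ∀ x, IsOpen (O x)) (hxO : ∀ x, x ∈ O x) :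
    ∃ U : M → Set M, (∀ x, IsOpen (U x) ∧ x ∈ U x ∧ IsPathConnected (U x) ∧ U x ⊆ O x) ∧
      ∀ x x', (U x ∩ U x').Nonempty → HasSectionsOn p (U x ∪ U x') := by
  let _ := TopologicalSpace.metrizableSpaceMetric M
  choose W hWo hxW hW using exists_hasSectionsOn cov hp
  obtain ⟨δ, hδ, hball⟩ := lebesgue_number_lemma_of_metric (isCompact_univ (X := M)) hWo
    (fun x _ => Set.mem_iUnion.2 ⟨x, hxW x⟩)
  have hxB : ∀ x, x ∈ ball x (δ / 4) ∩ O x := fun x => ⟨mem_ball_self (by positivity), hxO x⟩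
  let U : M → Set M := fun x => pathComponentIn (ball x (δ / 4) ∩ O x) x
  have hUB : ∀ x, U x ⊆ ball x (δ / 4) ∩ O x := fun x => pathComponentIn_subset
  refine ⟨U, fun x => ⟨(isOpen_ball.inter (hO x)).pathComponentIn x,
    mem_pathComponentIn_self (hxB x), isPathConnected_pathComponentIn (hxB x),
    (hUB x).trans Set.inter_subset_right⟩, ?_⟩
  rintro x x' ⟨y, hy, hy'⟩
  have hUy : ∀ {x}, y ∈ U x → U x ⊆ ball y δ := fun {x} hy w hw => by
    have hyx := mem_ball.1 (hUB x hy).1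
    have hwx := mem_ball.1 (hUB x hw).1
    rw [mem_ball]
    linarith [dist_triangle_right w y x]
  obtain ⟨i, hi⟩ := hball y trivial
  exact (hW i).mono ((Set.union_subset (hUy hy) (hUy hy')).trans hi)

end Coverings

section LowDegreeForms

variable {E : Type*} [NormedAddCommGroup E] [NormedSpace ℝ E]

/-- A `1`-form as a linear functional. -/
def toLinear : (E [⋀^Fin 1]→L[ℝ] ℝ) ≃ₗᵢ[ℝ] (E →L[ℝ] ℝ) :=
  (ContinuousAlternatingMap.ofSubsingletonLIE (𝕜 := ℝ) (E := E) (F := ℝ) (0 : Fin 1)).symm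

theorem toLinear_apply (A : E [⋀^Fin 1]→L[ℝ] ℝ) (v : E) : toLinear A v = A ![v] :=
  congrArg A (funext fun i => by fin_cases i; rfl)

theorem toLinear_compContinuousLinearMap (A : E [⋀^Fin 1]→L[ℝ] ℝ) (L : E →L[ℝ] E) :
    toLinear (A.compContinuousLinearMap L) = toLinear A ∘L L := rfl

theorem extDeriv_apply_pair (A : E → E [⋀^Fin 1]→L[ℝ] ℝ) (y u v : E) :
    extDeriv A y ![u, v] =
      fderiv ℝ (fun z => toLinear (A z)) y u v - fderiv ℝ (fun z => toLinear (A z)) y v u := by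
  have hderiv : ∀ u v, fderiv ℝ (fun z => toLinear (A z)) y u v = fderiv ℝ A y u ![v] :=
    fun u v => by
      rw [show (fun z => toLinear (A z)) = toLinear ∘ A from rfl,
        toLinear.comp_fderiv' (f := A), ← toLinear_apply]
      rfl
  have hzero : Fin.removeNth 0 ![u, v] = ![v] := by ext i; fin_cases i; rfl
  have hone : Fin.removeNth 1 ![u, v] = ![u] := by ext i; fin_cases i; rfl
  rw [hderiv, hderiv, extDeriv, ContinuousAlternatingMap.alternatizeUncurryFin_apply,
    Fin.sum_univ_two, hzero, hone]
  simp [sub_eq_add_neg]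

/-- A `2`-form as a bilinear form. -/
def toBilinear (Ω : E [⋀^Fin 2]→L[ℝ] ℝ) : E →L[ℝ] E →L[ℝ] ℝ :=
  (toLinear (E := E)).toContinuousLinearEquiv.toContinuousLinearMap ∘L Ω.curryLeft

theorem toBilinear_apply (Ω : E [⋀^Fin 2]→L[ℝ] ℝ) (u v : E) : toBilinear Ω u v = Ω ![u, v] :=
  toLinear_apply _ _

theorem toBilinear_compContinuousLinearMap (Ω : E [⋀^Fin 2]→L[ℝ] ℝ) (L : E →L[ℝ] E) :
    toBilinear (Ω.compContinuousLinearMap L) = (toBilinear Ω).bilinearComp L L := by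
  ext u v
  rw [toBilinear_apply, ContinuousLinearMap.bilinearComp_apply, toBilinear_apply]
  exact congrArg Ω (funext fun i => by fin_cases i <;> rfl)

theorem contDiffOn_toBilinear [FiniteDimensional ℝ E] {n : WithTop ℕ∞}
    {Ω : E → E [⋀^Fin 2]→L[ℝ] ℝ} {V : Set E} (h : ContDiffOn ℝ n Ω V) :
    ContDiffOn ℝ n (fun y => toBilinear (Ω y)) V := by
  refine contDiffOn_clm_apply.2 fun u => contDiffOn_clm_apply.2 fun v => ?_
  simp only [toBilinear_apply]
  exact (ContinuousAlternatingMap.apply ℝ E ℝ ![u, v]).contDiff.comp_contDiffOn h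

theorem isInvertible_bilinearComp [FiniteDimensional ℝ E] {B : E →L[ℝ] E →L[ℝ] ℝ} {L : E →L[ℝ] E}
    (hB : B.IsInvertible) (hL : L.IsInvertible) : (B.bilinearComp L L).IsInvertible := by
  refine isInvertible_of_injective fun u v huv => hL.injective (hB.injective ?_)
  ext w
  obtain ⟨w, rfl⟩ := hL.surjective w
  exact congrArg (fun f : E →L[ℝ] ℝ => f w) huv

theorem apply_inverse_bilinearComp [FiniteDimensional ℝ E] {B : E →L[ℝ] E →L[ℝ] ℝ}
    {L : E →L[ℝ] E} (hB : B.IsInvertible) (hL : L.IsInvertible) (f : E →L[ℝ] ℝ) :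
    L ((B.bilinearComp L L).inverse (f ∘L L)) = B.inverse f := by
  refine (hB.inverse_apply_eq.2 ?_).symm
  ext v
  obtain ⟨w, rfl⟩ := hL.surjective v
  exact congrArg (fun l : E →L[ℝ] ℝ => l w)
    (((isInvertible_bilinearComp hB hL).inverse_apply_eq (y := f ∘L L)).1 rfl)

end LowDegreeForms

section Pullback

open Topology

variable {E : Type*} [NormedAddCommGroup E] [NormedSpace ℝ E]
variable {E' : Type*} [NormedAddCommGroup E'] [NormedSpace ℝ E']
variable {E'' : Type*} [NormedAddCommGroup E''] [NormedSpace ℝ E'']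
variable {M : Type*} [TopologicalSpace M] [ChartedSpace E M]

section ModelDeriv

variable {N : Type*} [TopologicalSpace N] [ChartedSpace E' N]
variable {P : Type*} [TopologicalSpace P] [ChartedSpace E'' P]

variable (E E') in
/-- The derivative of a map between manifolds, read as a map between the model spaces (every
tangent space of a manifold is a copy of its model space). -/
def modelDeriv (f : M → N) (x : M) : E →L[ℝ] E' := mfderiv 𝓘(ℝ, E) 𝓘(ℝ, E') f x

theorem modelDeriv_comp {g : N → P} {f : M → N} {x : M}
    (hg : MDifferentiableAt 𝓘(ℝ, E') 𝓘(ℝ, E'') g (f x))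
    (hf : MDifferentiableAt 𝓘(ℝ, E) 𝓘(ℝ, E') f x) :
    modelDeriv E E'' (g ∘ f) x = modelDeriv E' E'' g (f x) ∘L modelDeriv E E' f x :=
  mfderiv_comp x hg hf

theorem modelDeriv_congr {f g : M → N} {x : M} (h : f =ᶠ[𝓝 x] g) :
    modelDeriv E E' f x = modelDeriv E E' g x :=
  h.mfderiv_eq

theorem modelDeriv_id (x : M) : modelDeriv E E id x = .id ℝ E :=
  mfderiv_id

theorem modelDeriv_eq_fderiv {f : E → E'} {y : E} : modelDeriv E E' f y = fderiv ℝ f y :=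
  mfderiv_eq_fderiv

end ModelDeriv

variable {N : Type*} [TopologicalSpace N] [ChartedSpace E N]
variable {P : Type*} [TopologicalSpace P] [ChartedSpace E P]

section FormAt

variable {k : ℕ}

namespace DiffForm

/-- The value of a form at a point, as an alternating form on the model space. -/
def formAt (η : DiffForm E M k) (x : M) : E [⋀^Fin k]→L[ℝ] ℝ := η x

theorem formAt_pullback (η : DiffForm E M k) (f : N → M) (x : N) :
    (η.pullback f).formAt x = (η.formAt (f x)).compContinuousLinearMap (modelDeriv E E f x) := rfl

theorem formAt_pullback_pullback (η : DiffForm E M k) {g : N → M} {f : P → N} {x : P}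
    (hg : MDifferentiableAt 𝓘(ℝ, E) 𝓘(ℝ, E) g (f x))
    (hf : MDifferentiableAt 𝓘(ℝ, E) 𝓘(ℝ, E) f x) :
    ((η.pullback g).pullback f).formAt x = (η.pullback (g ∘ f)).formAt x := by
  rw [formAt_pullback η, modelDeriv_comp hg hf]
  rfl

theorem formAt_pullback_congr (η : DiffForm E M k) {f g : N → M} {x : N} (h : f =ᶠ[𝓝 x] g) :
    (η.pullback f).formAt x = (η.pullback g).formAt x := by
  rw [formAt_pullback, formAt_pullback, modelDeriv_congr h, h.eq_of_nhds]

theorem inChart_eq (η : DiffForm E M k) (x : M) (y : E) :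
    η.inChart x y = (η.formAt ((extChartAt 𝓘(ℝ, E) x).symm y)).compContinuousLinearMap
      (modelDeriv E E (extChartAt 𝓘(ℝ, E) x).symm y) := rfl

end DiffForm

end FormAt

variable [IsManifold 𝓘(ℝ, E) ∞ M] {x : M}

theorem contMDiffAt_extChartAt_symm {y : E} (hy : y ∈ (extChartAt 𝓘(ℝ, E) x).target) :
    ContMDiffAt 𝓘(ℝ, E) 𝓘(ℝ, E) ∞ (extChartAt 𝓘(ℝ, E) x).symm y :=
  (contMDiffOn_extChartAt_symm x).contMDiffAt ((isOpen_extChartAt_target x).mem_nhds hy)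

theorem contMDiffAt_extChartAt_of_mem_source {z : M} (hz : z ∈ (extChartAt 𝓘(ℝ, E) x).source) :
    ContMDiffAt 𝓘(ℝ, E) 𝓘(ℝ, E) ∞ (extChartAt 𝓘(ℝ, E) x) z :=
  contMDiffAt_extChartAt' (by simpa only [extChartAt_source] using hz)

theorem isInvertible_modelDeriv_extChartAt_symm {y : E}
    (hy : y ∈ (extChartAt 𝓘(ℝ, E) x).target) :
    (modelDeriv E E (extChartAt 𝓘(ℝ, E) x).symm y).IsInvertible := by
  have : IsManifold 𝓘(ℝ, E) 1 M := IsManifold.of_le (n := ∞) (by norm_cast)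
  have h := isInvertible_mfderivWithin_extChartAt_symm (I := 𝓘(ℝ, E)) hy
  rwa [ModelWithCorners.range_eq_univ, mfderivWithin_univ] at h

namespace DiffForm

variable {k : ℕ} {F : E → M} {y : E}

theorem formAt_pullback_eventuallyEq (η : DiffForm E M k)
    (hF : ∀ᶠ w in 𝓝 y, ContMDiffAt 𝓘(ℝ, E) 𝓘(ℝ, E) ∞ F w) :
    (η.pullback F).formAt =ᶠ[𝓝 y] fun w =>
      (η.inChart (F y) (extChartAt 𝓘(ℝ, E) (F y) (F w))).compContinuousLinearMap
        (fderiv ℝ (extChartAt 𝓘(ℝ, E) (F y) ∘ F) w) := by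
  set χ := extChartAt 𝓘(ℝ, E) (F y)
  have hsource : ∀ᶠ w in 𝓝 y, F w ∈ χ.source :=
    hF.self_of_nhds.continuousAt.eventually_mem (extChartAt_source_mem_nhds (F y))
  filter_upwards [hF, hsource.eventually_nhds] with w hFw hw
  have hχ : MDifferentiableAt 𝓘(ℝ, E) 𝓘(ℝ, E) (χ ∘ F) w :=
    ((contMDiffAt_extChartAt_of_mem_source hw.self_of_nhds).comp w hFw).mdifferentiableAt (by simp)
  have hχsymm : MDifferentiableAt 𝓘(ℝ, E) 𝓘(ℝ, E) χ.symm (χ (F w)) :=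
    (contMDiffAt_extChartAt_symm (χ.map_source hw.self_of_nhds)).mdifferentiableAt (by simp)
  have hχF : F =ᶠ[𝓝 w] χ.symm ∘ (χ ∘ F) := hw.mono fun v hv => (χ.left_inv hv).symm
  rw [η.formAt_pullback_congr hχF, ← η.formAt_pullback_pullback (f := χ ∘ F) hχsymm hχ,
    ← modelDeriv_eq_fderiv]
  rfl

theorem contDiffAt_extChartAt_comp (hF : ContMDiffAt 𝓘(ℝ, E) 𝓘(ℝ, E) ∞ F y) :
    ContDiffAt ℝ ∞ (extChartAt 𝓘(ℝ, E) (F y) ∘ F) y :=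
  contMDiffAt_iff_contDiffAt.1
    ((contMDiffAt_extChartAt_of_mem_source (mem_extChartAt_source (F y))).comp y hF)

omit [IsManifold 𝓘(ℝ, E) ∞ M] in
theorem IsSmooth.contDiffAt_inChart {η : DiffForm E M k} (hη : η.IsSmooth) (x : M) :
    ContDiffAt ℝ ∞ (η.inChart x) (extChartAt 𝓘(ℝ, E) x x) :=
  (hη x).contDiffAt (extChartAt_target_mem_nhds x)

theorem IsSmooth.contDiffAt_toLinear_pullback {α : DiffForm E M 1} (hα : α.IsSmooth)
    (hF : ∀ᶠ w in 𝓝 y, ContMDiffAt 𝓘(ℝ, E) 𝓘(ℝ, E) ∞ F w) :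
    ContDiffAt ℝ ∞ (fun w => toLinear ((α.pullback F).formAt w)) y := by
  refine ContDiffAt.congr_of_eventuallyEq ?_
    ((α.formAt_pullback_eventuallyEq hF).fun_comp toLinear)
  have hχF := contDiffAt_extChartAt_comp hF.self_of_nhds
  exact (toLinear.contDiff.contDiffAt.comp y ((hα.contDiffAt_inChart (F y)).comp y hχF)).clm_comp
    (hχF.fderiv_right (by norm_cast))

theorem IsSmooth.extDeriv_pullback {η : DiffForm E M k} (hη : η.IsSmooth)
    (hF : ∀ᶠ w in 𝓝 y, ContMDiffAt 𝓘(ℝ, E) 𝓘(ℝ, E) ∞ F w) :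
    extDeriv (η.pullback F).formAt y = (η.d.pullback F).formAt y := by
  set χ := extChartAt 𝓘(ℝ, E) (F y)
  have hFy := hF.self_of_nhds
  have hχ : MDifferentiableAt 𝓘(ℝ, E) 𝓘(ℝ, E) χ (F y) :=
    (contMDiffAt_extChartAt_of_mem_source (mem_extChartAt_source (F y))).mdifferentiableAt
      (by simp)
  have hpull := _root_.extDeriv_pullback (f := χ ∘ F)
    ((hη.contDiffAt_inChart (F y)).differentiableAt (by simp)) (contDiffAt_extChartAt_comp hFy)
    (by simp; norm_cast)
  rw [(η.formAt_pullback_eventuallyEq hF).extDeriv_eq]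
  refine hpull.trans ?_
  rw [← modelDeriv_eq_fderiv, modelDeriv_comp hχ (hFy.mdifferentiableAt (by simp))]
  rfl

end DiffForm

end Pullback

section Primitives

open Topology

variable {E : Type*} [NormedAddCommGroup E] [NormedSpace ℝ E]
variable {M : Type*} [TopologicalSpace M] [ChartedSpace E M]
variable {N : Type*} [TopologicalSpace N] [ChartedSpace E N]

theorem IsSectionOn.contMDiffAt {p : N → M} {s : M → N} {U : Set M} {x : M}
    (hs : IsSectionOn p s U) (hp : IsLocalDiffeomorph 𝓘(ℝ, E) 𝓘(ℝ, E) ∞ p) (hU : IsOpen U)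
    (hx : x ∈ U) : ContMDiffAt 𝓘(ℝ, E) 𝓘(ℝ, E) ∞ s x := by
  obtain ⟨Φ, hΦ, hΦp⟩ := hp (s x)
  have hΦs : ∀ {w}, w ∈ U → s w ∈ Φ.source → Φ (s w) = w := fun hwU hw =>
    (hΦp hw).symm.trans (hs.right_inv _ hwU)
  have hsource : ∀ᶠ w in 𝓝 x, s w ∈ Φ.source :=
    (hs.continuousOn.continuousAt (hU.mem_nhds hx)).eventually_mem (Φ.open_source.mem_nhds hΦ)
  have hsΦ : s =ᶠ[𝓝 x] Φ.symm := by
    filter_upwards [hsource, hU.mem_nhds hx] with w hw hwU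
    exact (Φ.left_inv hw).symm.trans (congrArg Φ.symm (hΦs hwU hw))
  have hxΦ : x ∈ Φ.target := hΦs hx hΦ ▸ Φ.map_source hΦ
  exact (Φ.symm.contMDiffOn.contMDiffAt (Φ.open_target.mem_nhds hxΦ)).congr_of_eventuallyEq hsΦ

/-- The part of `U` in the domain of the chart around `x`, in the coordinates of this chart. -/
def chartDomain (x : M) (U : Set M) : Set E :=
  (extChartAt 𝓘(ℝ, E) x).target ∩ (extChartAt 𝓘(ℝ, E) x).symm ⁻¹' U

theorem isOpen_chartDomain (x : M) {U : Set M} (hU : IsOpen U) :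
    IsOpen (chartDomain x U : Set E) :=
  (continuousOn_extChartAt_symm x).isOpen_inter_preimage (isOpen_extChartAt_target x) hU

/-- The `1`-form `β` is a smooth primitive of the symplectic form `Ω` over `U`, in the sense that
its expressions in charts are primitives of those of `Ω`. -/
def IsPrimitiveOn (Ω : DiffForm E M 2) (β : DiffForm E M 1) (U : Set M) : Prop :=
  ∀ x, IsExactSymplecticOn (fun y => toBilinear (Ω.inChart x y))
    (fun y => toLinear (β.inChart x y)) (chartDomain x U)

variable [FiniteDimensional ℝ E]

namespace IsSymplectic

variable {Ω : DiffForm E M 2}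

theorem isInvertible_toBilinear (hΩ : IsSymplectic Ω) (x : M) :
    (toBilinear (Ω.formAt x)).IsInvertible := by
  refine isInvertible_of_injective ((injective_iff_map_eq_zero _).2 fun v hv =>
    hΩ.nondegenerate x v fun w => ?_)
  exact (toBilinear_apply (Ω.formAt x) v w).symm.trans (congrArg (fun f : E →L[ℝ] ℝ => f w) hv)

theorem isInvertible_inChart [IsManifold 𝓘(ℝ, E) ∞ M] (hΩ : IsSymplectic Ω) {x : M} {y : E}
    (hy : y ∈ (extChartAt 𝓘(ℝ, E) x).target) : (toBilinear (Ω.inChart x y)).IsInvertible := by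
  rw [Ω.inChart_eq, toBilinear_compContinuousLinearMap]
  exact isInvertible_bilinearComp (hΩ.isInvertible_toBilinear _)
    (isInvertible_modelDeriv_extChartAt_symm hy)

end IsSymplectic

theorem isPrimitiveOn_pullback [IsManifold 𝓘(ℝ, E) ∞ M] [IsManifold 𝓘(ℝ, E) ∞ N]
    {p : N → M} (hp : IsLocalDiffeomorph 𝓘(ℝ, E) 𝓘(ℝ, E) ∞ p) {Ω : DiffForm E M 2}
    (hΩ : IsSymplectic Ω) {α : DiffForm E N 1} (hα : α.IsSmooth)
    (hd : ∀ z, Ω.pullback p z = α.d z) {s : M → N} {U : Set M} (hs : IsSectionOn p s U)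
    (hU : IsOpen U) : IsPrimitiveOn Ω (α.pullback s) U := by
  intro x
  have hV := isOpen_chartDomain (E := E) x hU
  set χ := extChartAt 𝓘(ℝ, E) x
  have hχ : ∀ {w}, w ∈ chartDomain x U → ContMDiffAt 𝓘(ℝ, E) 𝓘(ℝ, E) ∞ χ.symm w :=
    fun hw => contMDiffAt_extChartAt_symm hw.1
  have hs' : ∀ {w}, w ∈ chartDomain x U → ContMDiffAt 𝓘(ℝ, E) 𝓘(ℝ, E) ∞ s (χ.symm w) :=
    fun hw => hs.contMDiffAt hp hU hw.2
  have hF : ∀ {y}, y ∈ chartDomain x U →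
      ∀ᶠ w in 𝓝 y, ContMDiffAt 𝓘(ℝ, E) 𝓘(ℝ, E) ∞ (s ∘ χ.symm) w := fun hy =>
    (hV.eventually_mem hy).mono fun w hw => (hs' hw).comp w (hχ hw)
  have hβ : ∀ {y}, y ∈ chartDomain x U →
      (α.pullback s).inChart x =ᶠ[𝓝 y] (α.pullback (s ∘ χ.symm)).formAt := fun hy =>
    (hV.eventually_mem hy).mono fun w hw => α.formAt_pullback_pullback
      ((hs' hw).mdifferentiableAt (by simp)) ((hχ hw).mdifferentiableAt (by simp))
  refine ⟨hV, (contDiffOn_toBilinear (hΩ.smooth x)).mono Set.inter_subset_left, fun y hy => ?_,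
    fun y hy => hΩ.isInvertible_inChart hy.1, fun y hy u v => ?_⟩
  · exact ((hα.contDiffAt_toLinear_pullback (hF hy)).congr_of_eventuallyEq
      ((hβ hy).fun_comp toLinear)).contDiffWithinAt
  · have hpF : p ∘ (s ∘ χ.symm) =ᶠ[𝓝 y] χ.symm :=
      (hV.eventually_mem hy).mono fun w hw => hs.right_inv _ hw.2
    have hα_d : α.d.pullback (s ∘ χ.symm) = (Ω.pullback p).pullback (s ∘ χ.symm) := by
      rw [show α.d = Ω.pullback p from funext fun z => (hd z).symm]
    rw [← extDeriv_apply_pair, (hβ hy).extDeriv_eq, hα.extDeriv_pullback (hF hy), hα_d,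
      Ω.formAt_pullback_pullback ((hp _).mdifferentiableAt (by simp))
        ((hF hy).self_of_nhds.mdifferentiableAt (by simp)),
      Ω.formAt_pullback_congr hpF, toBilinear_apply]
    rfl

/-- The Hamiltonian vector field of `φ`, defined by `Ω(X, ·) = dφ`. -/
def hamiltonianField (Ω : DiffForm E M 2) (φ : M → ℝ) (x : M) : E :=
  (toBilinear (Ω.formAt x)).inverse (modelDeriv E ℝ φ x)

/-- The value of the `1`-form `β` on the Hamiltonian vector field of `φ`. -/
def evalHamiltonian (β : DiffForm E M 1) (Ω : DiffForm E M 2) (φ : M → ℝ) (x : M) : ℝ :=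
  toLinear (β.formAt x) (hamiltonianField Ω φ x)

omit [FiniteDimensional ℝ E] in
theorem sum_evalHamiltonian_eq_zero (β : DiffForm E M 1) (Ω : DiffForm E M 2) {ι : Type*}
    [Fintype ι] {φ : ι → M → ℝ} {x : M} (hφ : ∀ i, MDifferentiableAt 𝓘(ℝ, E) 𝓘(ℝ, ℝ) (φ i) x)
    (hsum : ∀ z, ∑ i, φ i z = 1) : ∑ i, evalHamiltonian β Ω (φ i) x = 0 := by
  have hderiv : ∑ i, modelDeriv E ℝ (φ i) x = 0 := by
    have h : HasMFDerivAt 𝓘(ℝ, E) 𝓘(ℝ, ℝ) (fun z => ∑ i, φ i z) x (∑ i, modelDeriv E ℝ (φ i) x) :=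
      ⟨tendsto_finsetSum _ fun i _ => (hφ i).continuousAt,
        HasFDerivWithinAt.fun_sum fun i _ => (hφ i).hasMFDerivAt.2⟩
    rw [funext hsum] at h
    exact h.mfderiv.symm.trans mfderiv_const
  simp only [evalHamiltonian, hamiltonianField]
  rw [← map_sum, ← map_sum, hderiv, map_zero, map_zero]

section Smooth

variable [IsManifold 𝓘(ℝ, E) ∞ M] {Ω : DiffForm E M 2} {β : DiffForm E M 1} {φ : M → ℝ}

omit [FiniteDimensional ℝ E] in
theorem contDiffOn_comp_extChartAt_symm (hφ : ContMDiff 𝓘(ℝ, E) 𝓘(ℝ, ℝ) ∞ φ) (x : M) :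
    ContDiffOn ℝ ∞ (φ ∘ (extChartAt 𝓘(ℝ, E) x).symm) (extChartAt 𝓘(ℝ, E) x).target :=
  contMDiffOn_iff_contDiffOn.1 (hφ.comp_contMDiffOn (contMDiffOn_extChartAt_symm x))

/-- The Hamiltonian vector field of `φ` in the coordinates of the chart around `x`. -/
def chartHamiltonian (Ω : DiffForm E M 2) (φ : M → ℝ) (x : M) (y : E) : E :=
  (toBilinear (Ω.inChart x y)).inverse (fderiv ℝ (φ ∘ (extChartAt 𝓘(ℝ, E) x).symm) y)

theorem IsSymplectic.contDiffOn_chartHamiltonian (hΩ : IsSymplectic Ω)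
    (hφ : ContMDiff 𝓘(ℝ, E) 𝓘(ℝ, ℝ) ∞ φ) (x : M) :
    ContDiffOn ℝ ∞ (chartHamiltonian Ω φ x) (extChartAt 𝓘(ℝ, E) x).target :=
  contDiffOn_inverse_apply (contDiffOn_toBilinear (hΩ.smooth x))
    ((contDiffOn_comp_extChartAt_symm hφ x).fderiv_of_isOpen (isOpen_extChartAt_target x)
      (by norm_cast)) fun _ hy => hΩ.isInvertible_inChart hy

theorem IsSymplectic.hamiltonianField_extChartAt_symm (hΩ : IsSymplectic Ω)
    (hφ : ContMDiff 𝓘(ℝ, E) 𝓘(ℝ, ℝ) ∞ φ) {x : M} {y : E}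
    (hy : y ∈ (extChartAt 𝓘(ℝ, E) x).target) :
    hamiltonianField Ω φ ((extChartAt 𝓘(ℝ, E) x).symm y) =
      modelDeriv E E (extChartAt 𝓘(ℝ, E) x).symm y (chartHamiltonian Ω φ x y) := by
  rw [chartHamiltonian, ← modelDeriv_eq_fderiv, modelDeriv_comp (hφ.mdifferentiable (by simp) _)
      ((contMDiffAt_extChartAt_symm hy).mdifferentiableAt (by simp)), Ω.inChart_eq,
    toBilinear_compContinuousLinearMap, apply_inverse_bilinearComp (hΩ.isInvertible_toBilinear _)
      (isInvertible_modelDeriv_extChartAt_symm hy)]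
  rfl

theorem IsSymplectic.evalHamiltonian_extChartAt_symm (hΩ : IsSymplectic Ω) (β : DiffForm E M 1)
    (hφ : ContMDiff 𝓘(ℝ, E) 𝓘(ℝ, ℝ) ∞ φ) {x : M} {y : E}
    (hy : y ∈ (extChartAt 𝓘(ℝ, E) x).target) :
    evalHamiltonian β Ω φ ((extChartAt 𝓘(ℝ, E) x).symm y) =
      toLinear (β.inChart x y) (chartHamiltonian Ω φ x y) := by
  rw [evalHamiltonian, hΩ.hamiltonianField_extChartAt_symm hφ hy, β.inChart_eq,
    toLinear_compContinuousLinearMap, ContinuousLinearMap.comp_apply]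

theorem IsPrimitiveOn.continuousOn_evalHamiltonian {U : Set M} (h : IsPrimitiveOn Ω β U)
    (hΩ : IsSymplectic Ω) (hφ : ContMDiff 𝓘(ℝ, E) 𝓘(ℝ, ℝ) ∞ φ) (hU : IsOpen U) :
    ContinuousOn (evalHamiltonian β Ω φ) U := by
  intro x hx
  set χ := extChartAt 𝓘(ℝ, E) x
  have hchart : ContinuousOn (fun y => toLinear (β.inChart x y) (chartHamiltonian Ω φ x y))
      (chartDomain x U) :=
    (h x).contDiffOn_primitive.continuousOn.clm_apply
      ((hΩ.contDiffOn_chartHamiltonian hφ x).continuousOn.mono Set.inter_subset_left)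
  have hxU : χ x ∈ (chartDomain x U : Set E) :=
    ⟨mem_extChartAt_target x, by rwa [Set.mem_preimage, extChartAt_to_inv]⟩
  have hcomp := (hchart.continuousAt ((isOpen_chartDomain x hU).mem_nhds hxU)).comp
    (continuousAt_extChartAt x)
  refine (hcomp.congr ?_).continuousWithinAt
  filter_upwards [extChartAt_source_mem_nhds (I := 𝓘(ℝ, E)) x] with z hz
  rw [← χ.left_inv hz, hΩ.evalHamiltonian_extChartAt_symm β hφ (χ.map_source hz), χ.left_inv hz]
  rfl

end Smooth

end Primitives

section Integrals

open MeasureTheory Module Topology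

variable {E : Type*} [NormedAddCommGroup E] [NormedSpace ℝ E]
variable {M : Type*} [TopologicalSpace M] [ChartedSpace E M]

theorem chartDomain_mono (x : M) {U V : Set M} (h : U ⊆ V) :
    (chartDomain x U : Set E) ⊆ chartDomain x V :=
  Set.inter_subset_inter_right _ (Set.preimage_mono h)

theorem isCompact_chartDomain {x : M} {K : Set M} (hK : IsCompact K)
    (hKx : K ⊆ (extChartAt 𝓘(ℝ, E) x).source) : IsCompact (chartDomain x K : Set E) := by
  rw [chartDomain, ← (extChartAt 𝓘(ℝ, E) x).image_eq_target_inter_inv_preimage hKx]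
  exact hK.image_of_continuousOn ((continuousOn_extChartAt x).mono hKx)

/-- The function `φ` in the chart around `x`, extended by zero. -/
def chartFun (φ : M → ℝ) (x : M) : E → ℝ :=
  (extChartAt 𝓘(ℝ, E) x).target.indicator (φ ∘ (extChartAt 𝓘(ℝ, E) x).symm)

section ChartFun

variable {φ : M → ℝ} {x : M}

theorem chartFun_eventuallyEq (φ : M → ℝ) {y : E} (hy : y ∈ (extChartAt 𝓘(ℝ, E) x).target) :
    chartFun φ x =ᶠ[𝓝 y] φ ∘ (extChartAt 𝓘(ℝ, E) x).symm :=
  ((isOpen_extChartAt_target x).eventually_mem hy).mono fun _ hw => Set.indicator_of_mem hw _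

theorem tsupport_chartFun_subset (hc : HasCompactSupport φ)
    (hφ : tsupport φ ⊆ (extChartAt 𝓘(ℝ, E) x).source) :
    tsupport (chartFun φ x : E → ℝ) ⊆ chartDomain x (tsupport φ) := by
  refine closure_minimal (fun y hy => ?_) (isCompact_chartDomain hc hφ).isClosed
  have hyx : y ∈ (extChartAt 𝓘(ℝ, E) x).target := Set.mem_of_indicator_ne_zero hy
  rw [Function.mem_support, chartFun, Set.indicator_of_mem hyx] at hy
  exact ⟨hyx, subset_tsupport φ hy⟩

theorem hasCompactSupport_chartFun (hc : HasCompactSupport φ)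
    (hφ : tsupport φ ⊆ (extChartAt 𝓘(ℝ, E) x).source) :
    HasCompactSupport (chartFun φ x : E → ℝ) :=
  (isCompact_chartDomain hc hφ).of_isClosed_subset (isClosed_tsupport _)
    (tsupport_chartFun_subset hc hφ)

theorem contDiff_chartFun [IsManifold 𝓘(ℝ, E) ∞ M] (hφ : ContMDiff 𝓘(ℝ, E) 𝓘(ℝ, ℝ) ∞ φ)
    (hc : HasCompactSupport φ) (hs : tsupport φ ⊆ (extChartAt 𝓘(ℝ, E) x).source) :
    ContDiff ℝ ∞ (chartFun φ x : E → ℝ) := by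
  refine contDiff_of_tsupport fun y hy => ?_
  have hyx := (tsupport_chartFun_subset hc hs hy).1
  exact ((contDiffOn_comp_extChartAt_symm hφ x).contDiffAt
    ((isOpen_extChartAt_target x).mem_nhds hyx)).congr_of_eventuallyEq (chartFun_eventuallyEq φ hyx)

end ChartFun

section EvalHamiltonian

variable {β : DiffForm E M 1} {Ω : DiffForm E M 2} {φ : M → ℝ}

theorem tsupport_evalHamiltonian_subset (β : DiffForm E M 1) (Ω : DiffForm E M 2) (φ : M → ℝ) :
    tsupport (evalHamiltonian β Ω φ) ⊆ tsupport φ := by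
  refine closure_minimal (fun z hz => ?_) (isClosed_tsupport φ)
  by_contra hφ
  have hderiv : modelDeriv E ℝ φ z = 0 :=
    (modelDeriv_congr (notMem_tsupport_iff_eventuallyEq.1 hφ)).trans mfderiv_const
  refine hz ?_
  rw [evalHamiltonian, hamiltonianField, hderiv, map_zero, map_zero]

theorem IsPrimitiveOn.continuous_mul_evalHamiltonian [FiniteDimensional ℝ E]
    [IsManifold 𝓘(ℝ, E) ∞ M] {U : Set M} (h : IsPrimitiveOn Ω β U) (hΩ : IsSymplectic Ω)
    (hU : IsOpen U) (hφ : ContMDiff 𝓘(ℝ, E) 𝓘(ℝ, ℝ) ∞ φ) {θ : M → ℝ} (hθ : Continuous θ)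
    (hs : tsupport θ ∩ tsupport φ ⊆ U) : Continuous (θ * evalHamiltonian β Ω φ) := by
  refine continuous_of_tsupport fun z hz => ?_
  have hzU : z ∈ U := hs ⟨tsupport_mul_subset_left hz,
    tsupport_evalHamiltonian_subset β Ω φ (tsupport_mul_subset_right hz)⟩
  exact hθ.continuousAt.mul ((h.continuousOn_evalHamiltonian hΩ hφ hU).continuousAt
    (hU.mem_nhds hzU))

end EvalHamiltonian

variable [FiniteDimensional ℝ E]

/-- The density of the symplectic volume in the chart around `x`. -/
def chartDensity (Ω : DiffForm E M 2) (x : M) (y : E) : ℝ := density (toBilinear (Ω.inChart x y))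

/-- The integral of `h` over the domain of the chart around `x` against the symplectic volume. -/
def chartIntegral [MeasurableSpace E] (μ : Measure E) (Ω : DiffForm E M 2) (x : M) (h : M → ℝ) :
    ℝ :=
  ∫ y in (extChartAt 𝓘(ℝ, E) x).target,
    h ((extChartAt 𝓘(ℝ, E) x).symm y) * chartDensity Ω x y ∂μ

theorem IsSymplectic.continuousOn_chartDensity {Ω : DiffForm E M 2} (hΩ : IsSymplectic Ω) (x : M) :
    ContinuousOn (chartDensity Ω x) (extChartAt 𝓘(ℝ, E) x).target :=
  continuous_density.comp_continuousOn (contDiffOn_toBilinear (hΩ.smooth x)).continuousOn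

theorem chartDensity_eq_abs_det_mul [IsManifold 𝓘(ℝ, E) ∞ M] (Ω : DiffForm E M 2) {x x' : M}
    {y : E} (hy : y ∈ chartDomain x (extChartAt 𝓘(ℝ, E) x').source) :
    chartDensity Ω x y =
      |(fderiv ℝ (extChartAt 𝓘(ℝ, E) x' ∘ (extChartAt 𝓘(ℝ, E) x).symm) y).det| *
        chartDensity Ω x' ((extChartAt 𝓘(ℝ, E) x' ∘ (extChartAt 𝓘(ℝ, E) x).symm) y) := by
  set χ := extChartAt 𝓘(ℝ, E) x
  set χ' := extChartAt 𝓘(ℝ, E) x'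
  have hχ : MDifferentiableAt 𝓘(ℝ, E) 𝓘(ℝ, E) χ.symm y :=
    (contMDiffAt_extChartAt_symm hy.1).mdifferentiableAt (by simp)
  have hχ' : MDifferentiableAt 𝓘(ℝ, E) 𝓘(ℝ, E) χ' (χ.symm y) :=
    (contMDiffAt_extChartAt_of_mem_source hy.2).mdifferentiableAt (by simp)
  have hχ'symm : MDifferentiableAt 𝓘(ℝ, E) 𝓘(ℝ, E) χ'.symm ((χ' ∘ χ.symm) y) :=
    (contMDiffAt_extChartAt_symm (χ'.map_source hy.2)).mdifferentiableAt (by simp)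
  have hleft : χ'.symm ∘ (χ' ∘ χ.symm) =ᶠ[𝓝 y] χ.symm :=
    ((isOpen_chartDomain x (isOpen_extChartAt_source x')).eventually_mem hy).mono
      fun w hw => χ'.left_inv hw.2
  have hderiv : modelDeriv E E χ.symm y =
      modelDeriv E E χ'.symm ((χ' ∘ χ.symm) y) ∘L fderiv ℝ (χ' ∘ χ.symm) y := by
    rw [← modelDeriv_eq_fderiv, ← modelDeriv_comp hχ'symm (hχ'.comp y hχ), modelDeriv_congr hleft]
  have hform : toBilinear (Ω.inChart x y) =
      (toBilinear (Ω.inChart x' ((χ' ∘ χ.symm) y))).bilinearComp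
        (fderiv ℝ (χ' ∘ χ.symm) y) (fderiv ℝ (χ' ∘ χ.symm) y) := by
    rw [← toBilinear_compContinuousLinearMap, Ω.inChart_eq, Ω.inChart_eq, hderiv,
      Function.comp_apply, χ'.left_inv hy.2]
    rfl
  rw [chartDensity, hform, density_bilinearComp, chartDensity]

variable [MeasurableSpace E] [BorelSpace E] (μ : Measure E)

theorem chartIntegral_eq_setIntegral (Ω : DiffForm E M 2) (x : M) {h : M → ℝ} {U : Set M}
    (hs : Function.support h ⊆ U) :
    chartIntegral μ Ω x h =
      ∫ y in chartDomain x U, h ((extChartAt 𝓘(ℝ, E) x).symm y) * chartDensity Ω x y ∂μ := by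
  refine setIntegral_eq_of_subset_of_forall_sdiff_eq_zero
    (isOpen_extChartAt_target x).measurableSet Set.inter_subset_left fun y hy => ?_
  rw [Function.notMem_support.1 fun hyh => hy.2 ⟨hy.1, hs hyh⟩, zero_mul]

theorem chartIntegral_congr_chart [IsManifold 𝓘(ℝ, E) ∞ M] [μ.IsAddHaarMeasure]
    (Ω : DiffForm E M 2) {x x' : M} {h : M → ℝ}
    (hx : Function.support h ⊆ (extChartAt 𝓘(ℝ, E) x).source)
    (hx' : Function.support h ⊆ (extChartAt 𝓘(ℝ, E) x').source) :
    chartIntegral μ Ω x h = chartIntegral μ Ω x' h := by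
  set χ := extChartAt 𝓘(ℝ, E) x
  set χ' := extChartAt 𝓘(ℝ, E) x'
  have himage : (χ' ∘ χ.symm) '' chartDomain x χ'.source = chartDomain x' χ.source :=
    (χ.symm.trans χ').image_source_eq_target
  have hinj : Set.InjOn (χ' ∘ χ.symm) (chartDomain x χ'.source) := (χ.symm.trans χ').injOn
  have hmeas : MeasurableSet (chartDomain x χ'.source : Set E) :=
    (isOpen_chartDomain x (isOpen_extChartAt_source x')).measurableSet
  have hderiv : ∀ y ∈ chartDomain x χ'.source, HasFDerivWithinAt (χ' ∘ χ.symm)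
      (fderiv ℝ (χ' ∘ χ.symm) y) (chartDomain x χ'.source) y := fun y hy =>
    ((((contMDiffAt_extChartAt_of_mem_source hy.2).comp y
      (contMDiffAt_extChartAt_symm hy.1)).contDiffAt).differentiableAt
        (by simp)).hasFDerivAt.hasFDerivWithinAt
  rw [chartIntegral_eq_setIntegral μ Ω x hx', chartIntegral_eq_setIntegral μ Ω x' hx, ← himage,
    integral_image_eq_integral_abs_det_fderiv_smul μ hmeas hderiv hinj]
  refine setIntegral_congr_fun hmeas fun y hy => ?_
  simp only [smul_eq_mul]
  rw [chartDensity_eq_abs_det_mul Ω hy, Function.comp_apply, χ'.left_inv hy.2]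
  ring

omit [BorelSpace E] in
theorem chartIntegral_nonneg (Ω : DiffForm E M 2) (x : M) {h : M → ℝ} (hh : 0 ≤ h) :
    0 ≤ chartIntegral μ Ω x h :=
  integral_nonneg fun _ => mul_nonneg (hh _) (density_nonneg _)

namespace IsSymplectic

variable {Ω : DiffForm E M 2} {x : M} {h : M → ℝ}

theorem integrableOn_mul_chartDensity [IsFiniteMeasureOnCompacts μ] (hΩ : IsSymplectic Ω)
    (hh : Continuous h) (hc : HasCompactSupport h)
    (hs : tsupport h ⊆ (extChartAt 𝓘(ℝ, E) x).source) :
    IntegrableOn (fun y => h ((extChartAt 𝓘(ℝ, E) x).symm y) * chartDensity Ω x y)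
      (extChartAt 𝓘(ℝ, E) x).target μ := by
  have hcont : ContinuousOn (fun y => h ((extChartAt 𝓘(ℝ, E) x).symm y) * chartDensity Ω x y)
      (extChartAt 𝓘(ℝ, E) x).target :=
    (hh.comp_continuousOn (continuousOn_extChartAt_symm x)).mul (hΩ.continuousOn_chartDensity x)
  have hK : IsCompact (chartDomain x (tsupport h) : Set E) := isCompact_chartDomain hc hs
  refine ((hcont.mono Set.inter_subset_left).integrableOn_compact hK).of_forall_sdiff_eq_zero
    (isOpen_extChartAt_target x).measurableSet fun y hy => ?_
  rw [image_eq_zero_of_notMem_tsupport fun hyh => hy.2 ⟨hy.1, hyh⟩, zero_mul]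

theorem chartIntegral_sum [IsFiniteMeasureOnCompacts μ] (hΩ : IsSymplectic Ω) {ι : Type*}
    [Fintype ι] {h : ι → M → ℝ} (hh : ∀ i, Continuous (h i)) (hc : ∀ i, HasCompactSupport (h i))
    (hs : ∀ i, tsupport (h i) ⊆ (extChartAt 𝓘(ℝ, E) x).source) :
    chartIntegral μ Ω x (∑ i, h i) = ∑ i, chartIntegral μ Ω x (h i) := by
  simp only [chartIntegral, Finset.sum_apply, Finset.sum_mul]
  exact integral_finsetSum _ fun i _ => hΩ.integrableOn_mul_chartDensity μ (hh i) (hc i) (hs i)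

theorem abs_chartIntegral_le [IsFiniteMeasureOnCompacts μ] (hΩ : IsSymplectic Ω) {θ : M → ℝ}
    (hθ : Continuous θ) (hc : HasCompactSupport θ)
    (hs : tsupport θ ⊆ (extChartAt 𝓘(ℝ, E) x).source) {C : ℝ} (hC : ∀ z, |h z| ≤ C * θ z) :
    |chartIntegral μ Ω x h| ≤ C * chartIntegral μ Ω x θ := by
  rw [chartIntegral, chartIntegral, ← integral_const_mul, ← Real.norm_eq_abs]
  refine norm_integral_le_of_norm_le
    ((hΩ.integrableOn_mul_chartDensity μ hθ hc hs).const_mul C) (.of_forall fun y => ?_)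
  rw [Real.norm_eq_abs, abs_mul, abs_of_nonneg (a := chartDensity Ω x y) (density_nonneg _),
    ← mul_assoc]
  exact mul_le_mul_of_nonneg_right (hC _) (density_nonneg _)

variable [IsManifold 𝓘(ℝ, E) ∞ M]

theorem chartIntegral_pos [μ.IsAddHaarMeasure] (hΩ : IsSymplectic Ω) (hh : Continuous h)
    (h_nonneg : 0 ≤ h) (hc : HasCompactSupport h)
    (hs : tsupport h ⊆ (extChartAt 𝓘(ℝ, E) x).source) {z : M} (hz : h z ≠ 0) :
    0 < chartIntegral μ Ω x h := by
  set χ := extChartAt 𝓘(ℝ, E) x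
  refine (setIntegral_pos_iff_support_of_nonneg_ae
    (.of_forall fun y => mul_nonneg (h_nonneg _) (density_nonneg _))
    (hΩ.integrableOn_mul_chartDensity μ hh hc hs)).2 ?_
  have hzx : z ∈ χ.source := hs (subset_tsupport h hz)
  have hne : (chartDomain x (Function.support h) : Set E).Nonempty :=
    ⟨χ z, χ.map_source hzx, by rwa [Set.mem_preimage, χ.left_inv hzx]⟩
  refine ((isOpen_chartDomain x hh.isOpen_support).measure_pos μ hne).trans_le
    (measure_mono fun y hy => ⟨mul_ne_zero hy.2 ?_, hy.1⟩)
  exact (density_pos (hΩ.isInvertible_inChart hy.1)).ne'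

theorem chartIntegral_evalHamiltonian [μ.IsAddHaarMeasure] (hΩ : IsSymplectic Ω)
    {β : DiffForm E M 1} {U : Set M} (hβ : IsPrimitiveOn Ω β U) {φ : M → ℝ}
    (hφ : ContMDiff 𝓘(ℝ, E) 𝓘(ℝ, ℝ) ∞ φ) (hc : HasCompactSupport φ)
    (hU : tsupport φ ⊆ U) (hs : tsupport φ ⊆ (extChartAt 𝓘(ℝ, E) x).source) :
    chartIntegral μ Ω x (evalHamiltonian β Ω φ) = finrank ℝ E / 2 * chartIntegral μ Ω x φ := by
  have hT := (isOpen_extChartAt_target (I := 𝓘(ℝ, E)) x).measurableSet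
  have hsupport := tsupport_chartFun_subset hc hs
  have hzero : ∀ {y}, y ∉ (extChartAt 𝓘(ℝ, E) x).target → chartFun φ x =ᶠ[𝓝 y] 0 := fun hy =>
    notMem_tsupport_iff_eventuallyEq.1 fun hyφ => hy (hsupport hyφ).1
  have hleft : chartIntegral μ Ω x (evalHamiltonian β Ω φ) =
      ∫ y, toLinear (β.inChart x y) ((toBilinear (Ω.inChart x y)).inverse
        (fderiv ℝ (chartFun φ x) y)) * chartDensity Ω x y ∂μ := by
    rw [← setIntegral_eq_integral_of_forall_compl_eq_zero fun y hy => by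
      rw [(hzero hy).fderiv_eq, Pi.zero_def, fderiv_fun_const, Pi.zero_apply, map_zero, map_zero,
        zero_mul]]
    refine setIntegral_congr_fun hT fun y hy => ?_
    simp only [(chartFun_eventuallyEq φ hy).fderiv_eq, hΩ.evalHamiltonian_extChartAt_symm β hφ hy,
      chartHamiltonian]
  have hright : chartIntegral μ Ω x φ = ∫ y, chartFun φ x y * chartDensity Ω x y ∂μ := by
    rw [← setIntegral_eq_integral_of_forall_compl_eq_zero fun y hy => by
      rw [(hzero hy).self_of_nhds, Pi.zero_apply, zero_mul]]
    refine setIntegral_congr_fun hT fun y hy => ?_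
    simp only [(chartFun_eventuallyEq φ hy).self_of_nhds, Function.comp_apply]
  rw [hleft, hright]
  exact (hβ x).integral_primitive_inverse_fderiv μ (contDiff_chartFun hφ hc hs)
    (hasCompactSupport_chartFun hc hs) (hsupport.trans (chartDomain_mono x hU))

end IsSymplectic

end Integrals

section Bounds

open Topology

variable {E : Type*} [NormedAddCommGroup E] [NormedSpace ℝ E]
variable {M : Type*} [TopologicalSpace M] [ChartedSpace E M] [IsManifold 𝓘(ℝ, E) ∞ M]
variable {N : Type*} [TopologicalSpace N] [ChartedSpace E N]

/-- The value of a metric at a point, as a bilinear form on the model space. -/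
def metricAt (g : RiemannianMetricOn E M) (x : M) : E →L[ℝ] E →L[ℝ] ℝ := g.inner x

open scoped Bundle in
theorem eventually_metricAt_modelDeriv_le (g : RiemannianMetricOn E M) (x : M) :
    ∃ C, ∀ᶠ w in 𝓝 x, ∀ v, metricAt g w
      (modelDeriv E E (extChartAt 𝓘(ℝ, E) x).symm (extChartAt 𝓘(ℝ, E) x w) v)
      (modelDeriv E E (extChartAt 𝓘(ℝ, E) x).symm (extChartAt 𝓘(ℝ, E) x w) v) ≤
        (C * ‖v‖) ^ 2 := by
  have : IsManifold 𝓘(ℝ, E) 1 M := IsManifold.of_le (n := ∞) (by norm_cast)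
  let _ : Bundle.RiemannianBundle (fun x : M => TangentSpace 𝓘(ℝ, E) x) :=
    ⟨g.toRiemannianMetric⟩
  have : IsContinuousRiemannianBundle E (fun x : M => TangentSpace 𝓘(ℝ, E) x) :=
    ⟨⟨g.inner, g.contMDiff.continuous, fun _ _ _ => rfl⟩⟩
  have hmetric : ∀ (w : M) (u : TangentSpace 𝓘(ℝ, E) w), metricAt g w u u = ‖u‖ ^ 2 :=
    fun _ u => real_inner_self_eq_norm_sq u
  obtain ⟨C, -, hC⟩ := eventually_norm_symmL_trivializationAt_lt E
    (fun x : M => TangentSpace 𝓘(ℝ, E) x) x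
  refine ⟨C, ?_⟩
  filter_upwards [hC, (chartAt E x).open_source.mem_nhds (mem_chart_source E x)] with w hw hwx v
  have hsymmL := TangentBundle.symmL_trivializationAt (I := 𝓘(ℝ, E)) hwx
  rw [ModelWithCorners.range_eq_univ, mfderivWithin_univ] at hsymmL
  have hle := ContinuousLinearMap.le_of_opNorm_le _ hw.le v
  rw [hsymmL] at hle
  exact (hmetric w _).trans_le (pow_le_pow_left₀ (norm_nonneg _) hle 2)

theorem IsBoundedForm.exists_abs_toLinear_le_sqrt {g : RiemannianMetricOn E M} {p : N → M}
    {α : DiffForm E N 1} (hα : IsBoundedForm g p α)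
    (hp : ∀ z, Function.Injective (modelDeriv E E p z)) :
    ∃ C, ∀ z v, |toLinear (α.formAt z) v| ≤
      C * √(metricAt g (p z) (modelDeriv E E p z v) (modelDeriv E E p z v)) := by
  obtain ⟨C, hC⟩ := hα
  refine ⟨C, fun z v => ?_⟩
  set q := metricAt g (p z) (modelDeriv E E p z v) (modelDeriv E E p z v) with hq
  rcases eq_or_ne v 0 with rfl | hv
  · simp [hq]
  have hqpos : 0 < q := g.pos (p z) _ ((map_ne_zero_iff _ (hp z)).2 hv)
  have hunit : metricAt g (p z) (modelDeriv E E p z ((√q)⁻¹ • v))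
      (modelDeriv E E p z ((√q)⁻¹ • v)) = 1 := by
    simp only [map_smul, _root_.smul_apply, smul_eq_mul, ← hq]
    rw [← mul_assoc, ← mul_inv, Real.mul_self_sqrt hqpos.le, inv_mul_cancel₀ hqpos.ne']
  have hle : |toLinear (α.formAt z) ((√q)⁻¹ • v)| ≤ C := by
    rw [toLinear_apply]
    refine hC z ![(√q)⁻¹ • v] fun i => ?_
    rw [Subsingleton.elim i 0]
    exact hunit
  rwa [map_smul, smul_eq_mul, abs_mul, abs_of_pos (inv_pos.2 (Real.sqrt_pos.2 hqpos)),
    inv_mul_le_iff₀ (Real.sqrt_pos.2 hqpos), mul_comm] at hle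

omit [IsManifold 𝓘(ℝ, E) ∞ M] in
theorem IsSectionOn.modelDeriv_apply_modelDeriv {p : N → M} {s : M → N} {U : Set M} {x : M}
    (hs : IsSectionOn p s U) (hp : IsLocalDiffeomorph 𝓘(ℝ, E) 𝓘(ℝ, E) ∞ p) (hU : IsOpen U)
    (hx : x ∈ U) (v : E) : modelDeriv E E p (s x) (modelDeriv E E s x v) = v := by
  have hps : p ∘ s =ᶠ[𝓝 x] id := (hU.eventually_mem hx).mono hs.right_inv
  rw [← ContinuousLinearMap.comp_apply, ← modelDeriv_comp ((hp _).mdifferentiableAt (by simp))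
    ((hs.contMDiffAt hp hU hx).mdifferentiableAt (by simp)), modelDeriv_congr hps, modelDeriv_id,
    ContinuousLinearMap.id_apply]

variable [FiniteDimensional ℝ E]

theorem IsSymplectic.exists_metricAt_hamiltonianField_le [CompactSpace M] {Ω : DiffForm E M 2}
    (hΩ : IsSymplectic Ω) (g : RiemannianMetricOn E M) {φ : M → ℝ}
    (hφ : ContMDiff 𝓘(ℝ, E) 𝓘(ℝ, ℝ) ∞ φ) :
    ∃ C, ∀ x, metricAt g x (hamiltonianField Ω φ x) (hamiltonianField Ω φ x) ≤ C := by
  have hlocal : ∀ x : M, ∃ C, ∀ᶠ w in 𝓝 x,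
      metricAt g w (hamiltonianField Ω φ w) (hamiltonianField Ω φ w) ≤ C := by
    intro x
    set χ := extChartAt 𝓘(ℝ, E) x
    obtain ⟨C, hC⟩ := eventually_metricAt_modelDeriv_le g x
    have hcont : ContinuousAt (fun w => ‖chartHamiltonian Ω φ x (χ w)‖) x :=
      (((hΩ.contDiffOn_chartHamiltonian hφ x).continuousOn.continuousAt
        (extChartAt_target_mem_nhds x)).comp (continuousAt_extChartAt x)).norm
    refine ⟨(|C| * (‖chartHamiltonian Ω φ x (χ x)‖ + 1)) ^ 2, ?_⟩
    filter_upwards [hC, hcont.eventually_lt_const (lt_add_one _),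
      extChartAt_source_mem_nhds (I := 𝓘(ℝ, E)) x] with w hw hlt hwx
    have hfield := hΩ.hamiltonianField_extChartAt_symm hφ (χ.map_source hwx)
    rw [χ.left_inv hwx] at hfield
    rw [hfield]
    refine (hw _).trans (sq_le_sq.2 ?_)
    rw [abs_mul, abs_mul, abs_abs, abs_norm]
    gcongr
    exact hlt.le.trans (le_abs_self _)
  choose C hC using hlocal
  obtain ⟨t, ht⟩ := CompactSpace.elim_nhds_subcover _ hC
  refine ⟨∑ x ∈ t, |C x|, fun w => ?_⟩
  obtain ⟨x, hx, hwx⟩ := Set.mem_iUnion₂.1 (ht.superset (Set.mem_univ w))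
  exact le_trans (b := C x) hwx ((le_abs_self _).trans
    (Finset.single_le_sum (f := fun x => |C x|) (fun _ _ => abs_nonneg _) hx))

/-- The bound does not depend on the section, since a section of `p` is isometric for `p^* g`. -/
theorem IsBoundedForm.exists_abs_evalHamiltonian_pullback_le [CompactSpace M]
    {g : RiemannianMetricOn E M} {p : N → M} {α : DiffForm E N 1} (hα : IsBoundedForm g p α)
    (hp : IsLocalDiffeomorph 𝓘(ℝ, E) 𝓘(ℝ, E) ∞ p) {Ω : DiffForm E M 2} (hΩ : IsSymplectic Ω)
    {φ : M → ℝ} (hφ : ContMDiff 𝓘(ℝ, E) 𝓘(ℝ, ℝ) ∞ φ) :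
    ∃ C, ∀ (U : Set M) (s : M → N), IsOpen U → IsSectionOn p s U →
      ∀ x ∈ U, |evalHamiltonian (α.pullback s) Ω φ x| ≤ C := by
  have hinj : ∀ z, Function.Injective (modelDeriv E E p z) := fun z =>
    ((hp z).mfderivToContinuousLinearEquiv (by simp)).injective
  obtain ⟨C, hC⟩ := hα.exists_abs_toLinear_le_sqrt hinj
  obtain ⟨D, hD⟩ := hΩ.exists_metricAt_hamiltonianField_le g hφ
  refine ⟨|C| * √D, fun U s hU hs x hx => ?_⟩
  have hle := hC (s x) (modelDeriv E E s x (hamiltonianField Ω φ x))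
  rw [hs.modelDeriv_apply_modelDeriv hp hU hx, hs.right_inv x hx] at hle
  rw [evalHamiltonian, DiffForm.formAt_pullback, toLinear_compContinuousLinearMap]
  refine hle.trans (mul_le_mul (le_abs_self C) (Real.sqrt_le_sqrt (hD x)) ?_ (abs_nonneg C))
  exact Real.sqrt_nonneg _

end Bounds

section Amenability

/-- The mass transport principle: averaged over an amenable group, what the `i` send equals what the
`j` receive. -/
theorem IsAmenable.sum_eq_sum {G : Type*} [Group G] (hG : IsAmenable G) {ι κ : Type*} [Fintype ι]
    [Fintype κ] {F : ι → κ → G → ℝ} (hF : ∀ i j, ∃ C, ∀ g, |F i j g| ≤ C) (a : ι → κ → G)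
    {r : ι → ℝ} (hr : ∀ i g, ∑ j, F i j (a i j * g) = r i) {c : κ → ℝ}
    (hc : ∀ j g, ∑ i, F i j g = c j) : ∑ i, r i = ∑ j, c j := by
  obtain ⟨m, -, hone, hinv⟩ := hG
  let one : boundedFunctions G := ⟨fun _ => 1, 1, fun _ => abs_one.le⟩
  have hm_const : ∀ {x} {f : boundedFunctions G}, (∀ g, f.1 g = x) → m f = x := by
    intro x f hf
    have hx : f = x • one := Subtype.ext (funext fun g => (hf g).trans (mul_one x).symm)
    rw [hx, map_smul, hone one fun _ => rfl, smul_eq_mul, mul_one]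
  let f (i : ι) (j : κ) : boundedFunctions G := ⟨F i j, hF i j⟩
  let f' (i : ι) (j : κ) : boundedFunctions G :=
    ⟨fun g => F i j (a i j * g), (hF i j).imp fun _ hC _ => hC _⟩
  have hrow : ∀ i, m (∑ j, f' i j) = r i := fun i =>
    hm_const fun g => by
      simpa only [f', AddSubmonoidClass.coe_finsetSum, Finset.sum_apply] using hr i g
  have hcol : ∀ j, m (∑ i, f i j) = c j := fun j =>
    hm_const fun g => by
      simpa only [f, AddSubmonoidClass.coe_finsetSum, Finset.sum_apply] using hc j g
  calc ∑ i, r i = ∑ i, ∑ j, m (f' i j) := by simp only [← hrow, map_sum]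
    _ = ∑ i, ∑ j, m (f i j) := by simp only [hinv (a _ _) (f _ _) (f' _ _) fun _ => rfl]
    _ = ∑ j, c j := by rw [Finset.sum_comm]; simp only [← hcol, map_sum]

end Amenability

section Flux

open MeasureTheory Module

/-- A smooth partition of unity on `M` subordinate to a cover by patches that lie in charts, with
lifts of the patches to `N` indexed by `G`. Over the overlaps the lifts of two patches differ by a
translation of the index. -/
structure LiftedPartition (E : Type*) [NormedAddCommGroup E] [NormedSpace ℝ E] {M N : Type*}
    [TopologicalSpace M] [ChartedSpace E M] [TopologicalSpace N] (p : N → M)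
    (G : Type*) [Group G] (ι : Type*) [Fintype ι] where
  /-- The chart around `center i` is the one that contains `patch i`. -/
  center : ι → M
  patch : ι → Set M
  isOpen_patch : ∀ i, IsOpen (patch i)
  patch_subset_source : ∀ i, patch i ⊆ (extChartAt 𝓘(ℝ, E) (center i)).source
  weight : ι → M → ℝ
  contMDiff_weight : ∀ i, ContMDiff 𝓘(ℝ, E) 𝓘(ℝ, ℝ) ∞ (weight i)
  weight_nonneg : ∀ i, 0 ≤ weight i
  sum_weight : ∀ x, ∑ i, weight i x = 1
  tsupport_weight_subset : ∀ i, tsupport (weight i) ⊆ patch i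
  lift : ι → G → M → N
  isSectionOn_lift : ∀ i g, IsSectionOn p (lift i g) (patch i)
  shift : ι → ι → G
  lift_eqOn : ∀ i j g, (patch i ∩ patch j).EqOn (lift i g) (lift j (shift i j * g))

namespace LiftedPartition

variable {E : Type*} [NormedAddCommGroup E] [NormedSpace ℝ E]
variable {M : Type*} [TopologicalSpace M] [ChartedSpace E M]
variable {N : Type*} [TopologicalSpace N] {p : N → M}
variable {G : Type*} [Group G] {ι : Type*} [Fintype ι] (P : LiftedPartition E p G ι)

theorem tsupport_weight_subset_source (i : ι) :
    tsupport (P.weight i) ⊆ (extChartAt 𝓘(ℝ, E) (P.center i)).source :=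
  (P.tsupport_weight_subset i).trans (P.patch_subset_source i)

theorem support_mul_evalHamiltonian_subset (β : DiffForm E M 1) (Ω : DiffForm E M 2) (i j : ι) :
    Function.support (P.weight j * evalHamiltonian β Ω (P.weight i)) ⊆ P.patch i ∩ P.patch j := by
  intro x hx
  rw [Function.mem_support, Pi.mul_apply, mul_ne_zero_iff] at hx
  exact ⟨P.tsupport_weight_subset i (tsupport_evalHamiltonian_subset β Ω _
    (subset_tsupport _ hx.2)), P.tsupport_weight_subset j (subset_tsupport _ hx.1)⟩

theorem sum_chartIntegral_pos [FiniteDimensional ℝ E] [MeasurableSpace E] [BorelSpace E]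
    [IsManifold 𝓘(ℝ, E) ∞ M] [CompactSpace M] [Nonempty M] (μ : Measure E) [μ.IsAddHaarMeasure]
    {Ω : DiffForm E M 2} (hΩ : IsSymplectic Ω) :
    0 < ∑ i, chartIntegral μ Ω (P.center i) (P.weight i) := by
  obtain ⟨x⟩ := ‹Nonempty M›
  obtain ⟨i, hi, hix⟩ := Finset.exists_ne_zero_of_sum_ne_zero
    ((P.sum_weight x).trans_ne one_ne_zero)
  refine Finset.sum_pos' (fun k _ => chartIntegral_nonneg μ Ω _ (P.weight_nonneg k)) ⟨i, hi, ?_⟩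
  exact hΩ.chartIntegral_pos μ (P.contMDiff_weight i).continuous (P.weight_nonneg i)
    (.of_compactSpace _) (P.tsupport_weight_subset_source i) hix

variable [ChartedSpace E N]

theorem mul_evalHamiltonian_lift (α : DiffForm E N 1) (Ω : DiffForm E M 2) (i j : ι) (g : G) :
    P.weight j * evalHamiltonian (α.pullback (P.lift i g)) Ω (P.weight i) =
      P.weight j * evalHamiltonian (α.pullback (P.lift j (P.shift i j * g))) Ω (P.weight i) := by
  funext x
  by_cases hx : x ∈ P.patch i ∩ P.patch j
  · have hlift := (P.lift_eqOn i j g).eventuallyEq_of_mem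
      (((P.isOpen_patch i).inter (P.isOpen_patch j)).mem_nhds hx)
    simp only [Pi.mul_apply, evalHamiltonian, α.formAt_pullback_congr hlift]
  · have hzero := fun β => Function.notMem_support.1 (Set.notMem_subset
      (P.support_mul_evalHamiltonian_subset β Ω i j) hx)
    rw [hzero, hzero]

variable [FiniteDimensional ℝ E]

theorem continuous_mul_evalHamiltonian [IsManifold 𝓘(ℝ, E) ∞ M] [IsManifold 𝓘(ℝ, E) ∞ N]
    {Ω : DiffForm E M 2} (hΩ : IsSymplectic Ω) {α : DiffForm E N 1}
    (hp : IsLocalDiffeomorph 𝓘(ℝ, E) 𝓘(ℝ, E) ∞ p) (hα : α.IsSmooth)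
    (hd : ∀ z, Ω.pullback p z = α.d z) {i j k : ι}
    (hk : tsupport (P.weight j) ∩ tsupport (P.weight i) ⊆ P.patch k) (g : G) :
    Continuous (P.weight j * evalHamiltonian (α.pullback (P.lift k g)) Ω (P.weight i)) :=
  (isPrimitiveOn_pullback hp hΩ hα hd (P.isSectionOn_lift k g)
    (P.isOpen_patch k)).continuous_mul_evalHamiltonian hΩ (P.isOpen_patch k) (P.contMDiff_weight i)
      (P.contMDiff_weight j).continuous hk

variable [MeasurableSpace E]

/-- The flux from `i` to `j`: the integral, against `weight j`, of the pairing of the primitive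
`α`, pulled back by `lift j g`, with the Hamiltonian field of `weight i`. -/
def flux (μ : Measure E) (Ω : DiffForm E M 2) (α : DiffForm E N 1) (i j : ι) (g : G) : ℝ :=
  chartIntegral μ Ω (P.center j)
    (P.weight j * evalHamiltonian (α.pullback (P.lift j g)) Ω (P.weight i))

variable [CompactSpace M] [IsManifold 𝓘(ℝ, E) ∞ M] [BorelSpace E] (μ : Measure E)
variable {Ω : DiffForm E M 2} (hΩ : IsSymplectic Ω) {α : DiffForm E N 1}
include hΩ

theorem exists_abs_flux_le [IsFiniteMeasureOnCompacts μ]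
    (hp : IsLocalDiffeomorph 𝓘(ℝ, E) 𝓘(ℝ, E) ∞ p) {γ : RiemannianMetricOn E M}
    (hα : IsBoundedForm γ p α) (i j : ι) : ∃ C, ∀ g, |P.flux μ Ω α i j g| ≤ C := by
  obtain ⟨C, hC⟩ := hα.exists_abs_evalHamiltonian_pullback_le hp hΩ (P.contMDiff_weight i)
  refine ⟨C * chartIntegral μ Ω (P.center j) (P.weight j), fun g => hΩ.abs_chartIntegral_le μ
    (P.contMDiff_weight j).continuous (.of_compactSpace _) (P.tsupport_weight_subset_source j)
      fun x => ?_⟩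
  by_cases hx : x ∈ P.patch j
  · rw [Pi.mul_apply, abs_mul, abs_of_nonneg (P.weight_nonneg j x), mul_comm]
    exact mul_le_mul_of_nonneg_right (hC _ _ (P.isOpen_patch j) (P.isSectionOn_lift j g) x hx)
      (P.weight_nonneg j x)
  · have hzero : P.weight j x = 0 :=
      image_eq_zero_of_notMem_tsupport (Set.notMem_subset (P.tsupport_weight_subset j) hx)
    simp only [Pi.mul_apply, hzero, zero_mul, abs_zero, mul_zero, le_refl]

variable [IsManifold 𝓘(ℝ, E) ∞ N] (hp : IsLocalDiffeomorph 𝓘(ℝ, E) 𝓘(ℝ, E) ∞ p)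
  (hα : α.IsSmooth) (hd : ∀ z, Ω.pullback p z = α.d z)
include hp hα hd

/-- The derivatives of a partition of unity sum to zero. -/
theorem sum_flux_eq_zero [IsFiniteMeasureOnCompacts μ] (j : ι) (g : G) :
    ∑ i, P.flux μ Ω α i j g = 0 := by
  have hsum : ∑ i, P.weight j * evalHamiltonian (α.pullback (P.lift j g)) Ω (P.weight i) = 0 := by
    rw [← Finset.mul_sum]
    refine funext fun x => ?_
    rw [Pi.mul_apply, Finset.sum_apply, sum_evalHamiltonian_eq_zero _ _
      (fun i => (P.contMDiff_weight i).mdifferentiable (by simp) x) P.sum_weight, mul_zero,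
      Pi.zero_apply]
  simp only [flux]
  rw [← hΩ.chartIntegral_sum μ (fun i => P.continuous_mul_evalHamiltonian hΩ hp hα hd
    (Set.inter_subset_left.trans (P.tsupport_weight_subset j)) g) (fun i => .of_compactSpace _)
    fun i => (tsupport_mul_subset_left).trans (P.tsupport_weight_subset_source j), hsum]
  simp [chartIntegral]

theorem sum_flux_shift_mul [μ.IsAddHaarMeasure] (i : ι) (g : G) :
    ∑ j, P.flux μ Ω α i j (P.shift i j * g) =
      finrank ℝ E / 2 * chartIntegral μ Ω (P.center i) (P.weight i) := by
  set f := evalHamiltonian (α.pullback (P.lift i g)) Ω (P.weight i)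
  have hflux : ∀ j, P.flux μ Ω α i j (P.shift i j * g) =
      chartIntegral μ Ω (P.center i) (P.weight j * f) := fun j => by
    have hsupp := P.support_mul_evalHamiltonian_subset (α.pullback (P.lift i g)) Ω i j
    rw [flux, ← P.mul_evalHamiltonian_lift]
    exact chartIntegral_congr_chart μ Ω
      (hsupp.trans (Set.inter_subset_right.trans (P.patch_subset_source j)))
      (hsupp.trans (Set.inter_subset_left.trans (P.patch_subset_source i)))
  have hsum : ∑ j, P.weight j * f = f := by
    rw [← Finset.sum_mul, show ∑ j, P.weight j = 1 from funext fun x => by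
      rw [Finset.sum_apply, P.sum_weight, Pi.one_apply], one_mul]
  rw [Finset.sum_congr rfl fun j _ => hflux j, ← hΩ.chartIntegral_sum μ
    (fun j => P.continuous_mul_evalHamiltonian hΩ hp hα hd
      (Set.inter_subset_right.trans (P.tsupport_weight_subset i)) g) (fun j => .of_compactSpace _)
    fun j => tsupport_mul_subset_right.trans ((tsupport_evalHamiltonian_subset _ _ _).trans
      (P.tsupport_weight_subset_source i)), hsum]
  exact hΩ.chartIntegral_evalHamiltonian μ
    (isPrimitiveOn_pullback hp hΩ hα hd (P.isSectionOn_lift i g) (P.isOpen_patch i))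
    (P.contMDiff_weight i) (.of_compactSpace _) (P.tsupport_weight_subset i)
    (P.tsupport_weight_subset_source i)

omit [MeasurableSpace E] [BorelSpace E] in
include P in
theorem not_isAmenable [Nonempty M] (hE : 0 < finrank ℝ E) {γ : RiemannianMetricOn E M}
    (hb : IsBoundedForm γ p α) : ¬ IsAmenable G := by
  intro hG
  let _ : MeasurableSpace E := borel E
  have : BorelSpace E := ⟨rfl⟩
  let μ : Measure E := Measure.addHaar
  have hbalance := hG.sum_eq_sum (P.exists_abs_flux_le μ hΩ hp hb) P.shift
    (P.sum_flux_shift_mul μ hΩ hp hα hd) (P.sum_flux_eq_zero μ hΩ hp hα hd)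
  rw [← Finset.mul_sum, Finset.sum_const_zero] at hbalance
  exact (mul_pos (by positivity) (P.sum_chartIntegral_pos μ hΩ)).ne' hbalance

end LiftedPartition

theorem exists_liftedPartition (E : Type*) [NormedAddCommGroup E] [NormedSpace ℝ E]
    [FiniteDimensional ℝ E] {M : Type*} [TopologicalSpace M] [ChartedSpace E M]
    [IsManifold 𝓘(ℝ, E) ∞ M] [T2Space M] [CompactSpace M] [ConnectedSpace M] {N : Type*}
    [TopologicalSpace N] {p : N → M} (cov : IsCoveringMap p) (hp : Function.Surjective p) (x₀ : M) :
    ∃ t : Finset M, Nonempty (LiftedPartition E p (FundamentalGroup M x₀) t) := by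
  have := ChartedSpace.locallyPathConnectedSpace E M
  have : PathConnectedSpace M := pathConnectedSpace_iff_connectedSpace.2 inferInstance
  have := ChartedSpace.secondCountable_of_sigmaCompact E M
  obtain ⟨U, hU, hsec⟩ := exists_cover_hasSectionsOn_union cov hp
    (isOpen_extChartAt_source (I := 𝓘(ℝ, E))) (mem_extChartAt_source (I := 𝓘(ℝ, E)))
  obtain ⟨t, ht⟩ := CompactSpace.elim_nhds_subcover U fun x => (hU x).1.mem_nhds (hU x).2.1
  obtain ⟨φ, hφ⟩ := SmoothPartitionOfUnity.exists_isSubordinate 𝓘(ℝ, E) isClosed_univ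
    (fun i : t => U i) (fun i => (hU i).1) (ht.superset.trans (Set.biUnion_eq_iUnion _ _).subset)
  obtain ⟨s, hs, hshift⟩ := exists_equivariant_sections cov hp x₀
    (fun i : t => (hU i).2.2.1) fun i j => hsec i j
  have hshift' : ∀ i j : t, ∃ a, ∀ g, (U i ∩ U j).EqOn (s i g) (s j (a * g)) := fun i j => by
    rcases (U i ∩ U j).eq_empty_or_nonempty with hij | hij
    · exact ⟨1, fun g => hij ▸ Set.eqOn_empty _ _⟩
    · exact hshift i j hij
  choose a ha using hshift'
  exact ⟨t, ⟨{
    center := (↑)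
    patch := fun i => U i
    isOpen_patch := fun i => (hU i).1
    patch_subset_source := fun i => (hU i).2.2.2
    weight := fun i => φ i
    contMDiff_weight := fun i => (φ i).contMDiff
    weight_nonneg := fun i => φ.nonneg i
    sum_weight := fun x => (finsum_eq_sum_of_fintype _).symm.trans (φ.sum_eq_one (Set.mem_univ x))
    tsupport_weight_subset := hφ
    lift := s
    isSectionOn_lift := hs
    shift := a
    lift_eqOn := ha }⟩⟩

end Flux

end SymplecticHyperbolic

end

theorem theoremT_general
    {E : Type*} [NormedAddCommGroup E] [NormedSpace ℝ E] [FiniteDimensional ℝ E]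
    (hE : 0 < Module.finrank ℝ E)
    {M : Type*} [TopologicalSpace M] [ChartedSpace E M] [IsManifold 𝓘(ℝ, E) ∞ M]
    [T2Space M] [CompactSpace M] [ConnectedSpace M]
    {N : Type*} [TopologicalSpace N] [ChartedSpace E N] [IsManifold 𝓘(ℝ, E) ∞ N]
    {p : N → M} (cov : IsCoveringMap p) (surj : Function.Surjective p)
    (hp : IsLocalDiffeomorph 𝓘(ℝ, E) 𝓘(ℝ, E) ∞ p) {Ω : SymplecticHyperbolic.DiffForm E M 2}
    (hΩ : SymplecticHyperbolic.IsSymplecticallyHyperbolic p Ω) (x₀ : M) :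
    ¬ SymplecticHyperbolic.IsAmenable (FundamentalGroup M x₀) := by
  obtain ⟨hsymp, γ, α, hα, hd, hb⟩ := hΩ
  obtain ⟨t, ⟨P⟩⟩ := SymplecticHyperbolic.exists_liftedPartition E cov surj x₀
  exact P.not_isAmenable hsymp hp hα hd hE hb

theorem theoremT
    {E : Type*} [NormedAddCommGroup E] [NormedSpace ℝ E] [FiniteDimensional ℝ E]
    (hE : 0 < Module.finrank ℝ E)
    {M : Type*} [TopologicalSpace M] [ChartedSpace E M] [IsManifold 𝓘(ℝ, E) ∞ M]
    [T2Space M] [CompactSpace M] [ConnectedSpace M]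
    {N : Type*} [TopologicalSpace N] [ChartedSpace E N] [IsManifold 𝓘(ℝ, E) ∞ N]
    (p : N → M) (hp : SymplecticHyperbolic.IsUniversalCovering E p)
    (Ω : SymplecticHyperbolic.DiffForm E M 2)
    (hΩ : SymplecticHyperbolic.IsSymplecticallyHyperbolic p Ω)
    (x₀ : M) :
    ¬ SymplecticHyperbolic.IsAmenable (FundamentalGroup M x₀) :=
  theoremT_general hE hp.isCoveringMap hp.surjective hp.isLocalDiffeomorph hΩ x₀
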